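/- Let $0\le p<1$ and $k=\lfloor 1/(1-p)\rfloor$. In the adversarial order secretary problem with $p$-sampling (AOS$p$) there are $n$ elements with distinct real values $\alpha_1,\dots,\alpha_n$ chosen by an adversary. Each element is sampled independently with probability $p$; $S$ is the set of sampled elements and $V$ the set of the remaining (online) ones. The adversary, knowing the values and $S$, chooses an order. The player, who knows $p$, first sees the values in $S$ and then the values in $V$ one by one in this order; at each of them she irrevocably either stops with it or rejects it. She wins if she stops with the largest value in $V$; if $V=\emptyset$ she wins by convention. An algorithm may be randomized, i.e. use a random seed independent of the sampling and unknown to the adversary. Its decisions may depend on the values seen so far, on the seed, and, for a player who knows $n$, also on $n$. Its success probability on size $n$ is the infimum, over the adversary's choices, of the probability of winning, and its success guarantee is the infimum of its success probabilities over all $n$. The $k$-max algorithm stops with the first online value that exceeds the $k$-th largest sampled value (taken to be $-\infty$ if there are fewer than $k$ samples); it does not use $n$. **Theorem.** For every $n$ and every choice of the adversary the $k$-max algorithm wins with probability at least $k p^k(1-p)$. For every $n>k$ its success probability is exactly $k p^k(1-p)+p^n$, where $p^n$ is the probability that $V=\emptyset$. Hence its success guarantee is exactly $k p^k(1-p)$.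 No algorithm, deterministic or randomized, has a success guarantee larger than $k p^k(1-p)$, even if the player knows $n$. The last two sentences remain true if the adversary must choose the values and the order without knowing $S$. -/

import Mathlib

open MeasureTheory

universe u

namespace AOS

/-- A possibly randomized online selection algorithm, for a player who may know the number `n` of
elements. Before the game a random seed is drawn. `accept n ω S [v₁, …, v_t]` says whether, with
seed `ω`, on an instance with `n` elements, having seen the set `S` of sampled values and having
rejected the online values `v₁, …, v_{t-1}`, the algorithm stops with the current one, `v_t`.
Deterministic algorithms are those with a one-point seed space (or with `accept` independent of
the seed); a player who does not know `n` has `accept` independent of `n`. -/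
structure Algorithm where
  Seed : Type u
  [measurableSpace : MeasurableSpace Seed]
  law : Measure Seed
  [isProbabilityMeasure : IsProbabilityMeasure law]
  accept : ℕ → Seed → Finset ℝ → List ℝ → Prop
  measurableSet_accept : ∀ n S h, MeasurableSet {ω | accept n ω S h}

attribute [instance] Algorithm.measurableSpace Algorithm.isProbabilityMeasure

/-- The player stops at position `t` (counted from `0`) of the online sequence `vs`: the first
position at which the history up to and including the current value is accepted. -/
def StopsAt (acc : List ℝ → Prop) (vs : List ℝ) (t : Fin vs.length) : Prop :=
  acc (vs.take (t + 1)) ∧ ∀ s < (t : ℕ), ¬ acc (vs.take (s + 1))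

/-- The player wins on the online sequence `vs`: she stops with its largest value. If there are
no online values she wins by convention. -/
def Wins (acc : List ℝ → Prop) (vs : List ℝ) : Prop :=
  vs = [] ∨ ∃ t : Fin vs.length, StopsAt acc vs t ∧ ∀ v ∈ vs, v ≤ vs.get t

/-- The values of the elements outside the sample set `S`, in the order `σ 0, σ 1, …`. -/
def onlineValues {n : ℕ} (α : Fin n ↪ ℝ) (σ : Equiv.Perm (Fin n)) (S : Finset (Fin n)) : List ℝ :=
  ((List.ofFn σ).filter (fun i => i ∉ S)).map α

/-- The probability that `A` wins when the `n` elements have the (distinct) values `α`, every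
element is sampled independently with probability `p`, and the order of arrival is `σ S` when `S`
is the set of sampled elements. -/
noncomputable def winProb (p : ℝ) (A : Algorithm.{u}) {n : ℕ} (α : Fin n ↪ ℝ)
    (σ : Finset (Fin n) → Equiv.Perm (Fin n)) : ℝ :=
  ∑ S : Finset (Fin n), p ^ S.card * (1 - p) ^ (n - S.card) *
    A.law.real {ω | Wins (A.accept n ω (S.map α)) (onlineValues α (σ S) S)}

/-- Success probability on `n` elements against an adversary who chooses the values and then,
knowing the set of sampled elements, the order. -/
noncomputable def successProb (p : ℝ) (A : Algorithm.{u}) (n : ℕ) : ℝ :=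
  ⨅ x : (Fin n ↪ ℝ) × (Finset (Fin n) → Equiv.Perm (Fin n)), winProb p A x.1 x.2

/-- Success guarantee: the infimum of the success probabilities over all sizes. -/
noncomputable def guarantee (p : ℝ) (A : Algorithm.{u}) : ℝ :=
  ⨅ n : ℕ, successProb p A n

/-- Success probability on `n` elements against an adversary who chooses the values and the order
without knowing the set of sampled elements. -/
noncomputable def obliviousSuccessProb (p : ℝ) (A : Algorithm.{u}) (n : ℕ) : ℝ :=
  ⨅ x : (Fin n ↪ ℝ) × Equiv.Perm (Fin n), winProb p A x.1 (fun _ => x.2)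

/-- Success guarantee against the adversary who does not know the set of sampled elements. -/
noncomputable def obliviousGuarantee (p : ℝ) (A : Algorithm.{u}) : ℝ :=
  ⨅ n : ℕ, obliviousSuccessProb p A n

/-- The `k`-th largest element (`k ≥ 1`) of a finite set of reals, `-∞` if there are fewer than `k`
elements. -/
noncomputable def kthLargest (k : ℕ) (S : Finset ℝ) : WithBot ℝ :=
  ((S.sort (· ≥ ·)).map (fun x : ℝ => (x : WithBot ℝ))).getD (k - 1) ⊥

/-- The `k`-max algorithm: stop with the first online value that exceeds the `k`-th largest
sampled value. It is deterministic and does not use `n`. -/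
noncomputable def kMax (k : ℕ) : Algorithm.{0} where
  Seed := Unit
  law := Measure.dirac ()
  accept := fun _ _ S h => ∃ v, h.getLast? = some v ∧ kthLargest k S < (v : WithBot ℝ)
  measurableSet_accept := fun _ _ _ => MeasurableSet.const _

end AOS

namespace AOS

/-! Lower bound. Call an online element acceptable if fewer than `k` sampled elements exceed it.
These are exactly the elements above the `k`-max threshold and they form an upper segment of the
online elements, so `k`-max wins in any order when there is exactly one. If the values arrive in
increasing order, it wins only then, or when nothing is online. Read in decreasing order of value,
the sampling is a word of independent coin flips, and the acceptable elements are the online letters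
before the `k`-th sampled one (`card_acceptable`). There is exactly one with probability `k p ^ k (1
- p)` if `k < n`; smaller `n` are handled by monotonicity.

Upper bound. It uses a fixed order only, so it covers both adversaries. The `T` smallest elements
arrive last, after the `M` largest in increasing order; to win when one of the `M` is online, the
player must stop at the last online one among them. Two kinds of information have to be taken from
her. The numerical values become useless when they are generic: along the ultrafilters
`genericList`, which are stable under deleting entries at fixed positions, her rejection
probabilities converge to limits depending only on `n` and the pattern of sampled and online
letters. The size `n` says nothing about `M`, because the small elements matter only through their
number of samples, and the binomial laws with parameters `n - M` and `n` merge as `n` grows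
(`tendsto_binomExp_sub`). A limit over an ultrafilter on the sizes gives one function `μ` of
patterns that serves all `M` at once.

Then `M` is made geometric with a small killing rate `d`. Given the number of samples, the word
splits into independent geometric gaps of online letters, and the task is to stop at the last online
letter. The best rule waits until at most `k` gaps remain, counting the current one, and then takes
the next online letter; its value is `gapValue`, proved to be an upper bound by backward induction
(`gapValue_step`, `levelSum_stopGain_le`). Letting `d` tend to `0` gives the bound
(`le_of_forall_le_wordExp`). -/

/-! ### Random words of samples and online letters -/

/-- Expectation of `f` over words of length `n` whose letters are independently `true` (sampled)
with probability `p` and `false` (online) with probability `1 - p`. -/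
noncomputable def wordExp (p : ℝ) : ℕ → (List Bool → ℝ) → ℝ
  | 0, f => f []
  | n + 1, f => p * wordExp p n (fun w => f (true :: w)) +
      (1 - p) * wordExp p n (fun w => f (false :: w))

theorem sum_fun_eq_wordExp (p : ℝ) (n : ℕ) (f : List Bool → ℝ) :
    ∑ b : Fin n → Bool, (∏ i, if b i then p else 1 - p) * f (List.ofFn b) = wordExp p n f := by
  induction n generalizing f with
  | zero => simp [wordExp]
  | succ n ih =>
    rw [← (Fin.consEquiv (fun _ : Fin (n + 1) => Bool)).sum_comp, Fintype.sum_prod_type]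
    simp only [wordExp, ← ih, Fin.consEquiv_apply, Fin.prod_univ_succ, Fin.cons_zero, Fin.cons_succ,
      List.ofFn_succ, Fintype.sum_bool, Finset.mul_sum, mul_assoc]
    simp

/-- The sampled set, read as a word along any enumeration of the elements, is a random word. -/
theorem sum_finset_eq_wordExp (p : ℝ) {n : ℕ} (e : Equiv.Perm (Fin n)) (f : List Bool → ℝ) :
    ∑ S : Finset (Fin n), p ^ S.card * (1 - p) ^ (n - S.card) *
      f (List.ofFn fun i => decide (e i ∈ S)) = wordExp p n f := by
  rw [← sum_fun_eq_wordExp]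
  refine Finset.sum_bij' (fun S _ i => decide (e i ∈ S))
    (fun b _ => Finset.univ.filter fun i => b (e.symm i)) ?_ ?_ ?_ ?_ ?_
  · simp
  · simp
  · intro S _; ext i; simp
  · intro b _; ext i; simp
  · intro S _
    congr 1
    rw [Equiv.prod_comp e (fun i => if decide (i ∈ S) = true then p else 1 - p)]
    simp only [decide_eq_true_eq]
    rw [Finset.prod_ite, Finset.prod_const, Finset.prod_const]
    congr 2
    · simp
    · rw [Finset.filter_not, Finset.card_sdiff_of_subset (Finset.filter_subset _ _)]
      simp

theorem wordExp_congr {p : ℝ} {n : ℕ} {f g : List Bool → ℝ}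
    (h : ∀ w : List Bool, w.length = n → f w = g w) : wordExp p n f = wordExp p n g := by
  induction n generalizing f g with
  | zero => exact h [] rfl
  | succ n ih =>
    simp only [wordExp]
    rw [ih (f := fun w => f (true :: w)) fun w hw => h _ (by simp [hw]),
      ih (f := fun w => f (false :: w)) fun w hw => h _ (by simp [hw])]

theorem wordExp_mono {p : ℝ} (hp0 : 0 ≤ p) (hp1 : p ≤ 1) {n : ℕ} {f g : List Bool → ℝ}
    (h : ∀ w : List Bool, w.length = n → f w ≤ g w) : wordExp p n f ≤ wordExp p n g := by
  induction n generalizing f g with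
  | zero => exact h [] rfl
  | succ n ih =>
    have h1p : 0 ≤ 1 - p := by linarith
    have h1 := ih (f := fun w => f (true :: w)) (g := fun w => g (true :: w))
      fun w hw => h _ (by simp [hw])
    have h2 := ih (f := fun w => f (false :: w)) (g := fun w => g (false :: w))
      fun w hw => h _ (by simp [hw])
    simp only [wordExp]
    gcongr

@[simp]
theorem wordExp_const (p : ℝ) (n : ℕ) (c : ℝ) : wordExp p n (fun _ => c) = c := by
  induction n with
  | zero => rfl
  | succ n ih => simp only [wordExp, ih]; ring

theorem wordExp_add (p : ℝ) (n : ℕ) (f g : List Bool → ℝ) :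
    wordExp p n (fun w => f w + g w) = wordExp p n f + wordExp p n g := by
  induction n generalizing f g with
  | zero => rfl
  | succ n ih => simp only [wordExp, ih]; ring

theorem wordExp_sub (p : ℝ) (n : ℕ) (f g : List Bool → ℝ) :
    wordExp p n (fun w => f w - g w) = wordExp p n f - wordExp p n g := by
  induction n generalizing f g with
  | zero => rfl
  | succ n ih => simp only [wordExp, ih]; ring

theorem wordExp_mul_left (p : ℝ) (n : ℕ) (c : ℝ) (f : List Bool → ℝ) :
    wordExp p n (fun w => c * f w) = c * wordExp p n f := by
  induction n generalizing f with
  | zero => rfl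
  | succ n ih => simp only [wordExp, ih]; ring

theorem wordExp_append (p : ℝ) (m n : ℕ) (f : List Bool → ℝ) :
    wordExp p (m + n) f = wordExp p m fun t => wordExp p n fun w => f (t ++ w) := by
  induction m generalizing f with
  | zero => simp [wordExp]
  | succ m ih =>
    rw [Nat.succ_add]
    simp only [wordExp, ih, List.cons_append]

theorem wordExp_comm (p : ℝ) (m n : ℕ) (f : List Bool → List Bool → ℝ) :
    (wordExp p m fun t => wordExp p n fun w => f t w) =
      wordExp p n fun w => wordExp p m fun t => f t w := by
  induction m generalizing f with
  | zero => rfl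
  | succ m ih =>
    simp only [wordExp, ih, wordExp_add, wordExp_mul_left]

theorem tendsto_wordExp {ι : Type*} {l : Filter ι} (p : ℝ) (n : ℕ) {f : ι → List Bool → ℝ}
    {g : List Bool → ℝ}
    (h : ∀ w : List Bool, w.length = n → Filter.Tendsto (fun i => f i w) l (nhds (g w))) :
    Filter.Tendsto (fun i => wordExp p n (f i)) l (nhds (wordExp p n g)) := by
  induction n generalizing f g with
  | zero => exact h [] rfl
  | succ n ih =>
    simp only [wordExp]
    exact ((ih fun w hw => h (true :: w) (by simp [hw])).const_mul p).add
      ((ih fun w hw => h (false :: w) (by simp [hw])).const_mul (1 - p))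

/-- The probability that all `n` elements are sampled. -/
theorem wordExp_all_sampled (p : ℝ) (n : ℕ) :
    (wordExp p n fun w => if false ∈ w then 0 else 1) = p ^ n := by
  induction n with
  | zero => simp [wordExp]
  | succ n ih =>
    simp only [wordExp, List.mem_cons, Bool.false_eq_true, false_or, ih, true_or, if_true,
      wordExp_const]
    ring

/-! ### The `k`-max algorithm -/

/-- In decreasing order, the sampled values above `v` form an initial segment, which must end before
index `k - 1`. The hypothesis `v ∉ S` excludes a tie with the threshold; with fewer than `k` samples
both sides are true. -/
theorem kthLargest_lt_iff {k : ℕ} (hk : 1 ≤ k) {S : Finset ℝ} {v : ℝ} (hv : v ∉ S) :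
    kthLargest k S < (v : WithBot ℝ) ↔ (S.filter (v < ·)).card < k := by
  have hlen : (S.sort (· ≥ ·)).length = S.card := Finset.length_sort _
  have hnd : (S.sort (· ≥ ·)).Nodup := Finset.sort_nodup _ _
  have hmem : ∀ x, x ∈ S.sort (· ≥ ·) ↔ x ∈ S := fun x => Finset.mem_sort _
  have hsorted : (S.sort (· ≥ ·)).Pairwise (· ≥ ·) := Finset.pairwise_sort _ _
  unfold kthLargest
  generalize S.sort (· ≥ ·) = L at *
  by_cases h : k - 1 < L.length
  · rw [List.getD_eq_getElem _ _ (by simpa using h), List.getElem_map, WithBot.coe_lt_coe]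
    constructor
    · intro hlt
      have hsub : S.filter (v < ·) ⊆ (L.take (k - 1)).toFinset := by
        intro x hx
        rw [Finset.mem_filter, ← hmem] at hx
        obtain ⟨i, hi, rfl⟩ := List.getElem_of_mem hx.1
        have hik : i < k - 1 := by
          by_contra! hle
          have hge : L[k - 1] ≥ L[i] := by
            rcases hle.eq_or_lt with heq | hlt'
            · simp [heq]
            · exact List.pairwise_iff_getElem.1 hsorted _ _ h hi hlt'
          linarith [hx.2]
        rw [List.mem_toFinset, List.mem_take_iff_getElem]
        exact ⟨i, by omega, rfl⟩
      calc _ ≤ _ := Finset.card_le_card hsub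
        _ ≤ (L.take (k - 1)).length := List.toFinset_card_le _
        _ < k := by rw [List.length_take]; omega
    · intro hcard
      by_contra! hle
      have hne : v ≠ L[k - 1] := fun he => hv ((hmem v).1 (he ▸ List.getElem_mem h))
      have hsub : (L.take k).toFinset ⊆ S.filter (v < ·) := by
        intro x hx
        rw [List.mem_toFinset, List.mem_take_iff_getElem] at hx
        obtain ⟨i, hi, rfl⟩ := hx
        rw [Finset.mem_filter, ← hmem]
        refine ⟨List.getElem_mem _, ?_⟩
        have hge : L[i] ≥ L[k - 1] := by
          rcases (show i ≤ k - 1 by omega).eq_or_lt with heq | hlt'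
          · simp [heq]
          · exact List.pairwise_iff_getElem.1 hsorted _ _ _ h hlt'
        exact (lt_of_le_of_ne hle hne).trans_le hge
      have := Finset.card_le_card hsub
      rw [List.toFinset_card_of_nodup (hnd.sublist (List.take_sublist _ _)), List.length_take] at this
      omega
  · rw [List.getD_eq_default _ _ (by simpa using h)]
    have := Finset.card_filter_le S (v < ·)
    exact ⟨fun _ => by omega, fun _ => WithBot.bot_lt_coe v⟩

theorem getLast?_take_succ {β : Type*} (vs : List β) {t : ℕ} (ht : t < vs.length) :
    (vs.take (t + 1)).getLast? = some vs[t] := by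
  rw [List.take_succ_eq_append_getElem ht, List.getLast?_concat]

/-- A player who accepts exactly one of the online values wins if it is the largest. -/
theorem wins_of_unique {P : ℝ → Prop} {vs : List ℝ} (hnd : vs.Nodup) {v : ℝ} (hv : v ∈ vs)
    (hP : P v) (huniq : ∀ x ∈ vs, P x → x = v) (hmax : ∀ x ∈ vs, x ≤ v) :
    Wins (fun h => ∃ x, h.getLast? = some x ∧ P x) vs := by
  obtain ⟨t, ht, rfl⟩ := List.getElem_of_mem hv
  refine Or.inr ⟨⟨t, ht⟩, ⟨⟨_, getLast?_take_succ vs ht, hP⟩, ?_⟩, by simpa using hmax⟩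
  rintro s hs ⟨x, hx, hPx⟩
  have hs : s < t := hs
  rw [getLast?_take_succ vs (hs.trans ht), Option.some.injEq] at hx
  subst hx
  have := huniq _ (List.getElem_mem _) hPx
  rw [hnd.getElem_inj_iff] at this
  omega

/-- On an increasing online sequence a threshold player wins only if the sequence has exactly one
acceptable value. -/
theorem unique_of_wins {P : ℝ → Prop} {vs : List ℝ} (hsorted : vs.Pairwise (· < ·))
    (hw : Wins (fun h => ∃ x, h.getLast? = some x ∧ P x) vs) :
    vs = [] ∨ ∃ v ∈ vs, P v ∧ ∀ x ∈ vs, P x → x = v := by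
  refine hw.imp id ?_
  rintro ⟨⟨t, ht⟩, ⟨⟨x, hx, hPx⟩, hnot⟩, hmax⟩
  rw [getLast?_take_succ vs ht, Option.some.injEq] at hx
  subst hx
  refine ⟨_, List.getElem_mem ht, hPx, ?_⟩
  intro y hy hPy
  obtain ⟨s, hs, rfl⟩ := List.getElem_of_mem hy
  rcases lt_trichotomy s t with hst | hst | hst
  · exact absurd ⟨_, getLast?_take_succ vs hs, hPy⟩ (hnot s hst)
  · simp [hst]
  · have h1 := List.pairwise_iff_getElem.1 hsorted _ _ ht hs hst
    have h2 : vs[s] ≤ vs[t] := hmax _ (List.getElem_mem hs)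
    linarith

/-! ### Winning of `k`-max in terms of acceptable elements -/

section Acceptable

variable {n : ℕ} (k : ℕ) (α : Fin n ↪ ℝ) (S : Finset (Fin n))

/-- The online elements with fewer than `k` sampled elements of larger value. -/
noncomputable def acceptable : Finset (Fin n) :=
  Finset.univ.filter fun i => i ∉ S ∧ (S.filter fun j => α i < α j).card < k

theorem mem_onlineValues {σ : Equiv.Perm (Fin n)} {v : ℝ} :
    v ∈ onlineValues α σ S ↔ ∃ i, i ∉ S ∧ α i = v := by
  simp only [onlineValues, List.mem_map, List.mem_filter, List.mem_ofFn', Set.mem_range,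
    decide_eq_true_eq]
  constructor
  · rintro ⟨i, ⟨-, hi⟩, rfl⟩; exact ⟨i, hi, rfl⟩
  · rintro ⟨i, hi, rfl⟩; exact ⟨i, ⟨⟨σ.symm i, by simp⟩, hi⟩, rfl⟩

theorem onlineValues_nodup (σ : Equiv.Perm (Fin n)) : (onlineValues α σ S).Nodup :=
  ((List.nodup_ofFn.2 σ.injective).filter _).map α.injective

theorem kthLargest_lt_apply_iff (hk : 1 ≤ k) {i : Fin n} (hi : i ∉ S) :
    kthLargest k (S.map α) < (α i : WithBot ℝ) ↔ i ∈ acceptable k α S := by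
  rw [kthLargest_lt_iff hk (by simpa using hi), Finset.filter_map, Finset.card_map]
  simp [acceptable, hi]

theorem onlineValues_eq_nil_iff {σ : Equiv.Perm (Fin n)} :
    onlineValues α σ S = [] ↔ S = Finset.univ := by
  rw [List.eq_nil_iff_forall_not_mem, Finset.eq_univ_iff_forall]
  simp only [mem_onlineValues]
  constructor
  · intro h i
    by_contra hi
    exact h _ ⟨i, hi, rfl⟩
  · rintro h _ ⟨i, hi, -⟩
    exact hi (h i)

/-- An online element larger than an acceptable one has even fewer samples above it, so it is
acceptable too. Hence a unique acceptable element is the online maximum, and it is the only one at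
which the player can stop. -/
theorem wins_kMax_of_card_acceptable (hk : 1 ≤ k) (σ : Equiv.Perm (Fin n)) (m : ℕ) (ω : Unit)
    (h : S = Finset.univ ∨ (acceptable k α S).card = 1) :
    Wins ((kMax k).accept m ω (S.map α)) (onlineValues α σ S) := by
  rcases h with h | h
  · exact Or.inl ((onlineValues_eq_nil_iff α S).2 h)
  obtain ⟨i, hi⟩ := Finset.card_eq_one.1 h
  have hiS : i ∈ acceptable k α S := by simp [hi]
  have hi' := hiS
  rw [acceptable, Finset.mem_filter] at hi'
  refine wins_of_unique (P := fun v => kthLargest k (S.map α) < (v : WithBot ℝ)) (v := α i)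
    (onlineValues_nodup α S σ) ((mem_onlineValues α S).2 ⟨i, hi'.2.1, rfl⟩)
    ((kthLargest_lt_apply_iff k α S hk hi'.2.1).2 hiS) ?_ ?_
  · intro x hx hPx
    obtain ⟨j, hj, rfl⟩ := (mem_onlineValues α S).1 hx
    have := (kthLargest_lt_apply_iff k α S hk hj).1 hPx
    rw [hi, Finset.mem_singleton] at this
    rw [this]
  · intro x hx
    obtain ⟨j, hj, rfl⟩ := (mem_onlineValues α S).1 hx
    by_contra! hlt
    have : j ∈ acceptable k α S := by
      rw [acceptable, Finset.mem_filter]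
      refine ⟨Finset.mem_univ _, hj, lt_of_le_of_lt (Finset.card_le_card ?_) hi'.2.2⟩
      intro l hl
      rw [Finset.mem_filter] at hl ⊢
      exact ⟨hl.1, hlt.trans hl.2⟩
    rw [hi, Finset.mem_singleton] at this
    rw [this] at hlt
    exact lt_irrefl _ hlt

/-- With `α` increasing and the identity order, the player stops at the smallest acceptable element,
which is the maximum only if no other is acceptable. -/
theorem card_acceptable_of_wins_kMax (hk : 1 ≤ k) (hα : StrictMono α) (m : ℕ) (ω : Unit)
    (h : Wins ((kMax k).accept m ω (S.map α)) (onlineValues α 1 S)) :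
    S = Finset.univ ∨ (acceptable k α S).card = 1 := by
  have hsorted : (onlineValues α 1 S).Pairwise (· < ·) := by
    unfold onlineValues
    rw [List.pairwise_map]
    refine List.Pairwise.filter _ ?_
    rw [List.pairwise_ofFn]
    exact fun i j hij => hα hij
  rcases unique_of_wins (P := fun v => kthLargest k (S.map α) < (v : WithBot ℝ)) hsorted h
    with h | ⟨v, hv, hPv, huniq⟩
  · exact Or.inl ((onlineValues_eq_nil_iff α S).1 h)
  · obtain ⟨i, hi, rfl⟩ := (mem_onlineValues α S).1 hv
    refine Or.inr (Finset.card_eq_one.2 ⟨i, ?_⟩)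
    ext j
    rw [Finset.mem_singleton]
    constructor
    · intro hj
      have hjS : j ∉ S := (Finset.mem_filter.1 hj).2.1
      exact α.injective (huniq _ ((mem_onlineValues α S).2 ⟨j, hjS, rfl⟩)
        ((kthLargest_lt_apply_iff k α S hk hjS).2 hj))
    · rintro rfl
      exact (kthLargest_lt_apply_iff k α S hk hi).1 hPv

end Acceptable

/-! ### The law of the number of acceptable elements -/

/-- The number of online letters of a word that precede its `k`-th sampled letter. -/
def onlineBefore : ℕ → List Bool → ℕ
  | 0, _ => 0
  | _ + 1, [] => 0
  | k + 1, true :: w => onlineBefore k w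
  | k + 1, false :: w => onlineBefore (k + 1) w + 1

theorem card_filter_eq_onlineBefore (k : ℕ) {n : ℕ} (b : Fin n → Bool) :
    (Finset.univ.filter fun i => b i = false ∧
      (Finset.univ.filter fun j => b j = true ∧ j < i).card < k).card =
      onlineBefore k (List.ofFn b) := by
  induction n generalizing k with
  | zero => cases k <;> simp [onlineBefore]
  | succ n ih =>
    cases k with
    | zero => simp [onlineBefore]
    | succ k =>
      rw [List.ofFn_succ, Fin.card_filter_univ_succ]
      have hc : ∀ i : Fin n, (Finset.univ.filter fun j => b j = true ∧ j < i.succ).card =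
          (if b 0 = true then 1 else 0) +
            (Finset.univ.filter fun j : Fin n => b j.succ = true ∧ j < i).card := by
        intro i
        rw [Fin.card_filter_univ_succ]
        simp only [Fin.succ_pos, and_true, Fin.succ_lt_succ_iff]
        split_ifs <;> simp [add_comm]
      simp only [hc]
      cases hb : b 0
      · simp [onlineBefore, ← ih]
      · simp [onlineBefore, ← ih, add_comm 1]

theorem card_acceptable (k : ℕ) {n : ℕ} (α : Fin n ↪ ℝ) (e : Equiv.Perm (Fin n))
    (he : StrictAnti (α ∘ e)) (S : Finset (Fin n)) :
    (acceptable k α S).card = onlineBefore k (List.ofFn fun i => decide (e i ∈ S)) := by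
  rw [← card_filter_eq_onlineBefore]
  symm
  refine Finset.card_bij (fun i _ => e i) ?_ (fun _ _ _ _ h => e.injective h) ?_
  all_goals
    have key : ∀ i : Fin n, (S.filter fun j => α (e i) < α j).card =
        (Finset.univ.filter fun j => decide (e j ∈ S) = true ∧ j < i).card := by
      intro i
      symm
      refine Finset.card_bij (fun j _ => e j) ?_ (fun _ _ _ _ h => e.injective h) ?_
      · intro j hj
        simp only [Finset.mem_filter, decide_eq_true_eq] at hj ⊢
        exact ⟨hj.2.1, he hj.2.2⟩
      · intro j hj
        simp only [Finset.mem_filter] at hj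
        refine ⟨e.symm j, ?_, by simp⟩
        simp only [Finset.mem_filter, Finset.mem_univ, Equiv.apply_symm_apply, decide_eq_true_eq, true_and]
        refine ⟨hj.1, he.lt_iff_gt.1 ?_⟩
        simpa using hj.2
  · intro i hi
    simpa [acceptable, key] using hi
  · intro i hi
    refine ⟨e.symm i, ?_, by simp⟩
    have := key (e.symm i)
    simp only [Equiv.apply_symm_apply] at this
    simpa [acceptable, this] using hi

theorem wordExp_onlineBefore_eq_zero (p : ℝ) (n k : ℕ) :
    (wordExp p n fun w => if onlineBefore k w = 0 then 1 else 0) = p ^ min n k := by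
  induction n generalizing k with
  | zero => cases k <;> simp [wordExp, onlineBefore]
  | succ n ih =>
    cases k with
    | zero => simp [onlineBefore]
    | succ k =>
      change p * wordExp p n (fun w => if onlineBefore k w = 0 then 1 else 0) + (1 - p) *
        wordExp p n (fun w => if onlineBefore (k + 1) w + 1 = 0 then 1 else 0) = _
      simp [ih, pow_succ, mul_comm]

/-- For `k < n` the event says that one of the first `k` letters is online and letter `k + 1` is
sampled. For `n ≤ k`, a word with an online letter never reaches its `k`-th sample, so the event is
that exactly one letter is online. -/
theorem wordExp_onlineBefore_eq_one (p : ℝ) (n k : ℕ) :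
    (wordExp p n fun w => if onlineBefore k w = 1 then 1 else 0) =
      if k < n then k * p ^ k * (1 - p) else n * p ^ (n - 1) * (1 - p) := by
  induction n generalizing k with
  | zero => cases k <;> simp [wordExp, onlineBefore]
  | succ n ih =>
    cases k with
    | zero => simp [onlineBefore]
    | succ k =>
      change p * wordExp p n (fun w => if onlineBefore k w = 1 then 1 else 0) + (1 - p) *
        wordExp p n (fun w => if onlineBefore (k + 1) w + 1 = 1 then 1 else 0) = _
      simp only [ih, Nat.add_eq_right, wordExp_onlineBefore_eq_zero, Nat.add_lt_add_iff_right]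
      split_ifs with h
      · rw [min_eq_right (by omega)]; push_cast; ring
      · rw [min_eq_left (by omega)]
        rcases n with _ | n
        · simp
        · rw [Nat.add_sub_cancel, Nat.add_sub_cancel]; push_cast; ring

theorem exists_strictAnti_comp {n : ℕ} (α : Fin n ↪ ℝ) :
    ∃ e : Equiv.Perm (Fin n), StrictAnti (α ∘ e) := by
  refine ⟨Tuple.sort (fun i => -α i), ?_⟩
  have h1 := Tuple.monotone_sort (fun i => -α i)
  have h2 : Antitone (α ∘ Tuple.sort fun i => -α i) := fun i j hij => by
    simpa using h1 hij
  exact h2.strictAnti_of_injective (α.injective.comp (Equiv.injective _))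

/-- The probability of the event in which `k`-max wins whatever the order is. -/
theorem sum_card_acceptable (p : ℝ) (k : ℕ) {n : ℕ} (α : Fin n ↪ ℝ) :
    ∑ S : Finset (Fin n), p ^ S.card * (1 - p) ^ (n - S.card) *
      (if S = Finset.univ ∨ (acceptable k α S).card = 1 then 1 else 0) =
      (if k < n then k * p ^ k * (1 - p) else n * p ^ (n - 1) * (1 - p)) + p ^ n := by
  obtain ⟨e, he⟩ := exists_strictAnti_comp α
  rw [← wordExp_onlineBefore_eq_one, ← wordExp_all_sampled, ← wordExp_add,
    ← sum_finset_eq_wordExp p e]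
  refine Finset.sum_congr rfl fun S _ => ?_
  congr 1
  have h1 : false ∈ (List.ofFn fun i => decide (e i ∈ S)) ↔ S ≠ Finset.univ := by
    rw [Ne, Finset.eq_univ_iff_forall, List.mem_ofFn', Set.mem_range]
    simp only [decide_eq_false_iff_not, not_forall]
    exact (e.surjective.exists (p := fun i => i ∉ S)).symm
  have h2 : S = Finset.univ → (acceptable k α S).card = 0 := by
    rintro rfl; simp [acceptable]
  simp only [← card_acceptable k α e he, h1]
  by_cases h : S = Finset.univ
  · rw [h2 h]; simp [h]
  · simp [h]

theorem winProb_kMax (p : ℝ) (k : ℕ) {n : ℕ} (α : Fin n ↪ ℝ)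
    (σ : Finset (Fin n) → Equiv.Perm (Fin n)) :
    winProb p (kMax k) α σ = ∑ S : Finset (Fin n), p ^ S.card * (1 - p) ^ (n - S.card) *
      open Classical in
      (if Wins ((kMax k).accept n () (S.map α)) (onlineValues α (σ S) S) then 1 else 0) := by
  classical
  unfold winProb
  refine Finset.sum_congr rfl fun S _ => ?_
  congr 1
  split_ifs with h
  · rw [show {ω | Wins ((kMax k).accept n ω (S.map α)) (onlineValues α (σ S) S)} = Set.univ from
      Set.eq_univ_of_forall fun _ => h]
    exact probReal_univ
  · rw [show {ω | Wins ((kMax k).accept n ω (S.map α)) (onlineValues α (σ S) S)} = ∅ from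
      Set.eq_empty_of_forall_notMem fun _ => h]
    simp

theorem le_winProb_kMax {p : ℝ} (hp0 : 0 ≤ p) (hp1 : p < 1) {k : ℕ} (hk : 1 ≤ k) {n : ℕ}
    (α : Fin n ↪ ℝ) (σ : Finset (Fin n) → Equiv.Perm (Fin n)) :
    (if k < n then k * p ^ k * (1 - p) else n * p ^ (n - 1) * (1 - p)) + p ^ n ≤
      winProb p (kMax k) α σ := by
  rw [winProb_kMax, ← sum_card_acceptable p k α]
  have : 0 ≤ 1 - p := by linarith
  gcongr with S
  split_ifs with h h' h'
  · exact le_rfl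
  · exact absurd (wins_kMax_of_card_acceptable k α S hk (σ S) n () h) h'
  · exact zero_le_one
  · exact le_rfl

theorem winProb_kMax_of_strictMono {p : ℝ} {k : ℕ} (hk : 1 ≤ k)
    {n : ℕ} {α : Fin n ↪ ℝ} (hα : StrictMono α) :
    winProb p (kMax k) α (fun _ => 1) =
      (if k < n then k * p ^ k * (1 - p) else n * p ^ (n - 1) * (1 - p)) + p ^ n := by
  rw [winProb_kMax, ← sum_card_acceptable p k α]
  refine Finset.sum_congr rfl fun S _ => ?_
  congr 1
  have : Wins ((kMax k).accept n () (S.map α)) (onlineValues α 1 S) ↔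
      S = Finset.univ ∨ (acceptable k α S).card = 1 :=
    ⟨card_acceptable_of_wins_kMax k α S hk hα n (), wins_kMax_of_card_acceptable k α S hk 1 n ()⟩
  simp only [this]

/-- This is the probability of at most one online letter among `n`, which can only drop when a
letter is added. It transfers the case `n ≤ k` to `n = k`. -/
theorem antitone_le_one_online {p : ℝ} (hp0 : 0 ≤ p) (hp1 : p < 1) :
    Antitone fun n : ℕ => (n : ℝ) * p ^ (n - 1) * (1 - p) + p ^ n := by
  refine antitone_nat_of_succ_le fun n => ?_
  rcases n with _ | n
  · simp
  · have h : 0 ≤ p ^ n * (1 - p) * ((n + 1) * (1 - p)) := by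
      have : 0 ≤ 1 - p := by linarith
      positivity
    simp only [Nat.add_sub_cancel]
    push_cast
    have h2 : p ^ (n + 1) = p ^ n * p := pow_succ _ _
    have h3 : p ^ (n + 1 + 1) = p ^ n * p * p := by rw [pow_succ, pow_succ]
    rw [h3, h2]
    linarith

theorem kMax_bound_le_winProb {p : ℝ} (hp0 : 0 ≤ p) (hp1 : p < 1) {k : ℕ} (hk : 1 ≤ k) {n : ℕ}
    (α : Fin n ↪ ℝ) (σ : Finset (Fin n) → Equiv.Perm (Fin n)) :
    k * p ^ k * (1 - p) ≤ winProb p (kMax k) α σ := by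
  refine le_trans ?_ (le_winProb_kMax hp0 hp1 hk α σ)
  have h1p : 0 ≤ 1 - p := by linarith
  split_ifs with h
  · have := pow_nonneg hp0 n
    linarith
  · refine le_trans ?_ (antitone_le_one_online hp0 hp1 (not_lt.1 h))
    have h2 : p ^ k ≤ p ^ (k - 1) := pow_le_pow_of_le_one hp0 hp1.le (Nat.sub_le _ _)
    have h3 : k * p ^ k * (1 - p) ≤ k * p ^ (k - 1) * (1 - p) := by gcongr
    have := pow_nonneg hp0 k
    linarith

/-! ### Optimal stopping for ordinal algorithms -/

/-- Remove from `l` the entry at the position of the last `false` of the word. -/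
def dropAtLast {β : Type*} : List Bool → List β → List β
  | b :: w, x :: l => if false ∈ w then x :: dropAtLast w l else if b then x :: l else l
  | _, l => l

/-- Remove the last `false` from a word. -/
def dropLastFalse (w : List Bool) : List Bool := dropAtLast w w

theorem dropLastFalse_append {h w : List Bool} (hw : false ∈ w) :
    dropLastFalse (h ++ w) = h ++ dropLastFalse w := by
  induction h with
  | nil => rfl
  | cons b h ih =>
    have : dropLastFalse (b :: (h ++ w)) = if false ∈ h ++ w then b :: dropLastFalse (h ++ w) else
      if b then b :: (h ++ w) else h ++ w := rfl
    rw [List.cons_append, this, if_pos (by simp [hw]), ih, List.cons_append]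

theorem dropLastFalse_false_cons {w : List Bool} (hw : false ∉ w) :
    dropLastFalse (false :: w) = w := by
  simp [dropLastFalse, dropAtLast, hw]

theorem dropLastFalse_append_replicate (h : List Bool) (m : ℕ) :
    dropLastFalse (h ++ false :: List.replicate m true) = h ++ List.replicate m true := by
  rw [dropLastFalse_append (by simp), dropLastFalse_false_cons (by simp)]

/-! ### Words of geometric length and backward induction over gaps -/

/-- Weighted sum of `G` over the words of length at most `N`, where a word has weight
`s ^ (number of true) * r ^ (number of false)`. -/
noncomputable def wordSum (s r : ℝ) : ℕ → (List Bool → ℝ) → ℝ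
  | 0, G => G []
  | N + 1, G => G [] + s * wordSum s r N (fun w => G (true :: w)) +
      r * wordSum s r N (fun w => G (false :: w))

/-- The part of `wordSum` over the words with exactly `m` letters `true`. -/
noncomputable def levelSum (s r : ℝ) : ℕ → ℕ → (List Bool → ℝ) → ℝ
  | 0, 0, G => G []
  | 0, _ + 1, _ => 0
  | N + 1, 0, G => G [] + r * levelSum s r N 0 (fun w => G (false :: w))
  | N + 1, m + 1, G => s * levelSum s r N m (fun w => G (true :: w)) +
      r * levelSum s r N (m + 1) (fun w => G (false :: w))

/-- After multiplication by `d`, this is an expectation over words of geometric length with killing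
rate `d`, truncated at length `N`. -/
theorem wordSum_eq_sum_wordExp (d p : ℝ) (N : ℕ) (G : List Bool → ℝ) :
    wordSum ((1 - d) * p) ((1 - d) * (1 - p)) N G =
      ∑ M ∈ Finset.range (N + 1), (1 - d) ^ M * wordExp p M G := by
  induction N generalizing G with
  | zero => simp [wordSum, wordExp]
  | succ N ih =>
    rw [Finset.sum_range_succ', wordSum, ih, ih]
    simp only [wordExp, pow_succ, Finset.mul_sum, pow_zero, one_mul]
    rw [add_comm _ (G []), add_assoc, ← Finset.sum_add_distrib]
    congr 1
    refine Finset.sum_congr rfl fun M _ => ?_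
    ring

theorem levelSum_eq_zero (s r : ℝ) {N m : ℕ} (h : N < m) (G : List Bool → ℝ) :
    levelSum s r N m G = 0 := by
  induction N generalizing m G with
  | zero =>
    obtain ⟨m, rfl⟩ := Nat.exists_eq_succ_of_ne_zero (by omega : m ≠ 0)
    rfl
  | succ N ih =>
    obtain ⟨m, rfl⟩ := Nat.exists_eq_succ_of_ne_zero (by omega : m ≠ 0)
    simp only [levelSum]
    rw [ih (by omega), ih (by omega)]
    simp

theorem sum_levelSum (s r : ℝ) (N : ℕ) (G : List Bool → ℝ) :
    ∑ m ∈ Finset.range (N + 1), levelSum s r N m G = wordSum s r N G := by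
  induction N generalizing G with
  | zero => simp [levelSum, wordSum]
  | succ N ih =>
    have h := ih fun w => G (false :: w)
    rw [Finset.sum_range_succ'] at h
    rw [Finset.sum_range_succ', wordSum, ← ih, ← h]
    simp only [levelSum, Finset.sum_add_distrib, ← Finset.mul_sum]
    rw [Finset.sum_range_succ _ N, Finset.sum_range_succ _ N, levelSum_eq_zero s r (Nat.lt_succ_self N)]
    ring

theorem levelSum_add (s r : ℝ) (N m : ℕ) (G H : List Bool → ℝ) :
    levelSum s r N m (fun w => G w + H w) = levelSum s r N m G + levelSum s r N m H := by
  induction N generalizing m G H with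
  | zero => cases m <;> simp [levelSum]
  | succ N ih => cases m <;> simp only [levelSum, ih] <;> ring

theorem levelSum_all_true (s r : ℝ) (N m : ℕ) (f : List Bool → ℝ) :
    levelSum s r N m (fun w => if false ∈ w then 0 else f w) =
      if m ≤ N then s ^ m * f (List.replicate m true) else 0 := by
  have hz : ∀ N m, levelSum s r N m (fun _ => 0) = 0 := by
    intro N
    induction N with
    | zero => intro m; cases m <;> rfl
    | succ N ih => intro m; cases m <;> simp [levelSum, ih]
  induction N generalizing m f with
  | zero => cases m <;> simp [levelSum]
  | succ N ih =>
    cases m with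
    | zero => simp [levelSum, hz]
    | succ m =>
      have := ih m fun w => f (true :: w)
      simp only [levelSum, List.mem_cons, Bool.false_eq_true, false_or, true_or, if_true, hz, this,
        Nat.add_le_add_iff_right, mul_zero, add_zero, List.replicate_succ]
      split_ifs <;> ring

/-- The value of the optimal stopping problem with `m` gaps left. -/
noncomputable def gapValue (k : ℕ) (q : ℝ) (m : ℕ) : ℝ :=
  (min m k : ℕ) * q ^ min m k * (1 - q)

/-- Below `k`, going from `m` to `m + 1` gaps multiplies `m q ^ m` by `(m + 1) q / m`, which is at
least `1` because `(m + 1) (1 - q) ≤ 1`; from `k` on the value is constant. -/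
theorem gapValue_le {k : ℕ} {q : ℝ} (hq0 : 0 ≤ q) (hq1 : q ≤ 1) (hkq : k * (1 - q) ≤ 1) (m : ℕ) :
    gapValue k q m ≤ k * q ^ k * (1 - q) := by
  have h1q : 0 ≤ 1 - q := by linarith
  have hmono : Monotone (gapValue k q) := by
    refine monotone_nat_of_le_succ fun m => ?_
    unfold gapValue
    rcases lt_or_ge m k with h | h
    · rw [min_eq_left h.le, min_eq_left (Nat.succ_le_of_lt h)]
      have h2 : ((m + 1 : ℕ) : ℝ) * (1 - q) ≤ 1 :=
        le_trans (mul_le_mul_of_nonneg_right (by exact_mod_cast h) h1q) hkq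
      have h3 : (m : ℝ) ≤ (m + 1 : ℕ) * q := by push_cast at h2 ⊢; linarith
      refine mul_le_mul_of_nonneg_right ?_ h1q
      calc (m : ℝ) * q ^ m ≤ ((m + 1 : ℕ) * q) * q ^ m := by gcongr
        _ = _ := by rw [pow_succ]; ring
    · rw [min_eq_right h, min_eq_right (by omega)]
  have := hmono (le_max_left m k)
  refine this.trans ?_
  simp [gapValue]

/-- One step of dynamic programming with `m + 1` gaps left. `Q` is the probability of still playing,
`Q'` that of still playing after an online letter is rejected. With probability `q` the gap ends;
otherwise an online letter comes, and stopping there wins if all `m + 1` gaps stay empty from then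
on, with probability `q ^ (m + 1)`. For `m < k` stopping is at least as good as continuing, since
`(m + 1) (1 - q) ≤ 1`; for `m ≥ k` continuing is at least as good, since `q ≤ k (1 - q)`. -/
theorem gapValue_step {k : ℕ} {q : ℝ} (hq0 : 0 ≤ q) (hq1 : q ≤ 1) (hkq : k * (1 - q) ≤ 1)
    (hkq' : 1 ≤ (k + 1) * (1 - q)) (m : ℕ) {Q Q' : ℝ} (hQ' : 0 ≤ Q') (hQ : Q' ≤ Q) :
    q * Q * gapValue k q m + (1 - q) * (Q' * gapValue k q (m + 1) + (Q - Q') * q ^ (m + 1)) ≤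
      Q * gapValue k q (m + 1) := by
  have h1q : 0 ≤ 1 - q := by linarith
  rcases lt_or_ge m k with h | h
  · have h2 : ((m + 1 : ℕ) : ℝ) * (1 - q) ≤ 1 :=
      le_trans (mul_le_mul_of_nonneg_right (by exact_mod_cast h) h1q) hkq
    have h3 : 0 ≤ (1 - q) * Q' * (q ^ (m + 1) * (1 - (m + 1 : ℕ) * (1 - q))) :=
      mul_nonneg (mul_nonneg h1q hQ') (mul_nonneg (by positivity) (by linarith))
    unfold gapValue
    rw [min_eq_left h.le, min_eq_left (Nat.succ_le_of_lt h)]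
    push_cast at *
    rw [pow_succ] at *
    linarith
  · have h2 : q ^ (m + 1) ≤ k * q ^ k * (1 - q) :=
      calc q ^ (m + 1) ≤ q ^ (k + 1) := pow_le_pow_of_le_one hq0 hq1 (by omega)
        _ = q ^ k * q := pow_succ _ _
        _ ≤ q ^ k * (k * (1 - q)) := by gcongr; linarith
        _ = _ := by ring
    have h3 : 0 ≤ (1 - q) * (Q - Q') * (k * q ^ k * (1 - q) - q ^ (m + 1)) :=
      mul_nonneg (mul_nonneg h1q (by linarith)) (by linarith)
    unfold gapValue
    rw [min_eq_right h, min_eq_right (by omega)]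
    linarith

/-- The probability that an ordinal algorithm stops exactly at the last online letter of `h ++ w`,
as a function of `w`, where `μ u` is the probability that it rejects all online letters of the
pattern `u`. -/
noncomputable def stopGain (μ : List Bool → ℝ) (h w : List Bool) : ℝ :=
  if false ∈ w then μ (dropLastFalse (h ++ w)) - μ (h ++ w) else 0

theorem stopGain_true_cons (μ : List Bool → ℝ) (h w : List Bool) :
    stopGain μ h (true :: w) = stopGain μ (h ++ [true]) w := by
  simp [stopGain]

theorem stopGain_false_cons (μ : List Bool → ℝ) (h w : List Bool) :
    stopGain μ h (false :: w) = stopGain μ (h ++ [false]) w +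
      (if false ∈ w then 0 else μ (dropLastFalse (h ++ false :: w)) - μ (h ++ false :: w)) := by
  by_cases hw : false ∈ w <;> simp [stopGain, hw]

/-- The samples are visible in advance, so with history `h` and `m` samples to come the player has
seen the pattern `h ++ List.replicate m true`; its `μ` is the probability that she is still playing.
Fixing the level `m` is what conditions on this knowledge. The weights supply a factor `q` for each
of the `m` gaps closed by a sample; the extra `q` on the left closes the last one. -/
theorem levelSum_stopGain_le {k : ℕ} {q x : ℝ} (hq0 : 0 ≤ q) (hq1 : q ≤ 1) (hx : 0 ≤ x)
    (hkq : k * (1 - q) ≤ 1) (hkq' : 1 ≤ (k + 1) * (1 - q)) {μ : List Bool → ℝ} (hμ0 : ∀ w, 0 ≤ μ w)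
    (hμ : ∀ h m, μ (h ++ false :: List.replicate m true) ≤ μ (h ++ List.replicate m true))
    (N m : ℕ) (h : List Bool) :
    q * levelSum (x * q) (1 - q) N m (stopGain μ h) ≤
      x ^ m * (μ (h ++ List.replicate m true) * gapValue k q (m + 1)) := by
  have h1q : 0 ≤ 1 - q := by linarith
  have hpos : ∀ m, 0 ≤ gapValue k q m := fun m => by unfold gapValue; positivity
  induction N generalizing m h with
  | zero =>
    have : levelSum (x * q) (1 - q) 0 m (stopGain μ h) = 0 := by
      cases m <;> simp [levelSum, stopGain]
    rw [this, mul_zero]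
    exact mul_nonneg (pow_nonneg hx _) (mul_nonneg (hμ0 _) (hpos _))
  | succ N ih =>
    have honline : q * levelSum (x * q) (1 - q) N m (fun w => stopGain μ h (false :: w)) ≤
        x ^ m * (μ (h ++ false :: List.replicate m true) * gapValue k q (m + 1) +
          (μ (h ++ List.replicate m true) - μ (h ++ false :: List.replicate m true)) *
            q ^ (m + 1)) := by
      simp only [stopGain_false_cons, levelSum_add, levelSum_all_true,
        dropLastFalse_append_replicate]
      have h1 := ih m (h ++ [false])
      rw [List.append_assoc, List.singleton_append] at h1
      have h2 : (if m ≤ N then (x * q) ^ m * (μ (h ++ List.replicate m true) -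
          μ (h ++ false :: List.replicate m true)) else 0) ≤ (x * q) ^ m *
            (μ (h ++ List.replicate m true) - μ (h ++ false :: List.replicate m true)) := by
        split_ifs
        · exact le_rfl
        · exact mul_nonneg (by positivity) (sub_nonneg.2 (hμ h m))
      have h3 := mul_le_mul_of_nonneg_left h2 hq0
      rw [mul_add, mul_add]
      refine add_le_add h1 (h3.trans (le_of_eq ?_))
      rw [mul_pow, pow_succ]
      ring
    have hstep := gapValue_step hq0 hq1 hkq hkq' m (hμ0 _) (hμ h m)
    have hstep' := mul_le_mul_of_nonneg_left hstep (pow_nonneg hx m)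
    have h4 := mul_le_mul_of_nonneg_left honline h1q
    cases m with
    | zero =>
      simp only [levelSum]
      have h0 : stopGain μ h [] = 0 := by simp [stopGain]
      rw [h0]
      have h5 : gapValue k q 0 = 0 := by simp [gapValue]
      rw [h5] at hstep'
      linarith
    | succ m =>
      simp only [levelSum]
      rw [funext (stopGain_true_cons μ h)]
      have h1 := mul_le_mul_of_nonneg_left (ih m (h ++ [true])) (mul_nonneg hx hq0)
      rw [List.append_assoc, List.singleton_append, ← List.replicate_succ] at h1
      rw [pow_succ] at hstep' h4 ⊢
      linarith

/-- No ordinal algorithm beats `k p ^ k (1 - p)` against all numbers `M` of relevant elements. -/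
theorem le_of_forall_le_wordExp {p : ℝ} (hp0 : 0 ≤ p) (hp1 : p < 1) {k : ℕ}
    (hkp : k * (1 - p) ≤ 1) (hkp' : 1 < (k + 1) * (1 - p)) {μ : List Bool → ℝ}
    (hμ0 : ∀ w, 0 ≤ μ w) (hμ1 : ∀ w, μ w ≤ 1)
    (hμ : ∀ h m, μ (h ++ false :: List.replicate m true) ≤ μ (h ++ List.replicate m true))
    {c : ℝ}
    (hc : ∀ M, c ≤ wordExp p M fun w => if false ∈ w then μ (dropLastFalse w) - μ w else 1) :
    c ≤ k * p ^ k * (1 - p) := by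
  have h1p : 0 < 1 - p := by linarith
  -- The words without online letters are conceded to the player; they will cost at most `d / (1 -
  -- p)`.
  have hc' : ∀ M, c ≤ wordExp p M (stopGain μ []) + p ^ M := by
    intro M
    rw [← wordExp_all_sampled, ← wordExp_add]
    refine (hc M).trans (le_of_eq (wordExp_congr fun w _ => ?_))
    by_cases hw : false ∈ w <;> simp [stopGain, hw]
  have hd : ∀ d : ℝ, 0 < d → d < 1 → 1 ≤ (k + 1) * ((1 - d) * (1 - p)) →
      c ≤ k * (1 - (1 - d) * (1 - p)) ^ k * ((1 - d) * (1 - p)) + d / (1 - p) := by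
    intro d hd0 hd1 hkd
    have h1d : 0 < 1 - d := by linarith
    -- `q` is the probability that the next letter is not online: it is a sample, or the word has
    -- ended.
    obtain ⟨q, hq⟩ : ∃ q, q = 1 - (1 - d) * (1 - p) := ⟨_, rfl⟩
    have hqr : (1 - d) * (1 - p) = 1 - q := by rw [hq]; ring
    have hqs : q = (1 - d) * p + d := by rw [hq]; ring
    have hq0 : 0 < q := by rw [hqs]; positivity
    have hq1 : q ≤ 1 := by have := mul_pos h1d h1p; linarith
    rw [← hq, hqr]
    rw [hqr] at hkd
    -- `x` is the probability that a gap is closed by a sample rather than by the end of the word.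
    obtain ⟨x, hx⟩ : ∃ x, x = (1 - d) * p / q := ⟨_, rfl⟩
    have hxq : x * q = (1 - d) * p := by rw [hx]; field_simp
    have hx0 : 0 ≤ x := by rw [hx]; positivity
    have hx1 : x < 1 := by rw [hx, div_lt_one hq0]; linarith
    have hkq : k * (1 - q) ≤ 1 := by
      refine le_trans (mul_le_mul_of_nonneg_left ?_ (Nat.cast_nonneg k)) hkp
      rw [← hqr]
      nlinarith
    have hK : 0 ≤ k * q ^ k * (1 - q) := by
      have : 0 ≤ 1 - q := by linarith
      positivity
    have hgeom : ∀ (y : ℝ) (N : ℕ), 0 ≤ y → y < 1 → ∑ m ∈ Finset.range N, y ^ m ≤ (1 - y)⁻¹ := by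
      intro y N hy0 hy1
      rw [← tsum_geometric_of_lt_one hy0 hy1]
      exact (summable_geometric_of_lt_one hy0 hy1).sum_le_tsum _ fun _ _ => by positivity
    have hgain : ∀ N, d * wordSum ((1 - d) * p) ((1 - d) * (1 - p)) N (stopGain μ []) ≤
        k * q ^ k * (1 - q) := by
      intro N
      have h1 : q * wordSum ((1 - d) * p) ((1 - d) * (1 - p)) N (stopGain μ []) ≤
          (1 - x)⁻¹ * (k * q ^ k * (1 - q)) := by
        rw [← sum_levelSum, Finset.mul_sum, ← hxq, hqr]
        calc _ ≤ ∑ m ∈ Finset.range (N + 1), x ^ m * (k * q ^ k * (1 - q)) := by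
              refine Finset.sum_le_sum fun m _ => ?_
              refine (levelSum_stopGain_le hq0.le hq1 hx0 hkq hkd hμ0 hμ N m []).trans ?_
              refine mul_le_mul_of_nonneg_left ?_ (by positivity)
              have h2 := gapValue_le hq0.le hq1 hkq (m + 1)
              calc _ ≤ μ ([] ++ List.replicate m true) * (k * q ^ k * (1 - q)) :=
                    mul_le_mul_of_nonneg_left h2 (hμ0 _)
                _ ≤ 1 * (k * q ^ k * (1 - q)) := mul_le_mul_of_nonneg_right (hμ1 _) hK
                _ = _ := one_mul _
          _ ≤ _ := by
              rw [← Finset.sum_mul]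
              exact mul_le_mul_of_nonneg_right (hgeom x _ hx0 hx1) hK
      have h2 : d = (1 - x) * q := by rw [sub_mul, hxq, hqs]; ring
      have h1x : 0 < 1 - x := by linarith
      calc _ = (1 - x) * (q * wordSum ((1 - d) * p) ((1 - d) * (1 - p)) N (stopGain μ [])) := by
            rw [← mul_assoc, ← h2]
        _ ≤ (1 - x) * ((1 - x)⁻¹ * (k * q ^ k * (1 - q))) := by gcongr
        _ = _ := by field_simp
    have hN : ∀ N : ℕ, c * (1 - (1 - d) ^ (N + 1)) ≤ k * q ^ k * (1 - q) + d / (1 - p) := by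
      intro N
      have h1 : 1 - (1 - d) ^ (N + 1) = d * ∑ M ∈ Finset.range (N + 1), (1 - d) ^ M := by
        have := mul_neg_geom_sum (1 - d) (N + 1)
        rw [sub_sub_cancel] at this
        exact this.symm
      have h2 := hgain N
      rw [wordSum_eq_sum_wordExp] at h2
      have h3 : ∑ M ∈ Finset.range (N + 1), (1 - d) ^ M * p ^ M ≤ (1 - p)⁻¹ := by
        refine (Finset.sum_le_sum fun M _ => ?_).trans (hgeom p (N + 1) hp0 hp1)
        have := pow_le_one₀ (n := M) h1d.le (by linarith)
        exact mul_le_of_le_one_left (by positivity) this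
      calc _ = d * ∑ M ∈ Finset.range (N + 1), (1 - d) ^ M * c := by
            rw [h1, ← Finset.sum_mul]; ring
        _ ≤ d * ∑ M ∈ Finset.range (N + 1), ((1 - d) ^ M * wordExp p M (stopGain μ []) +
              (1 - d) ^ M * p ^ M) := by
            refine mul_le_mul_of_nonneg_left (Finset.sum_le_sum fun M _ => ?_) hd0.le
            rw [← mul_add]
            exact mul_le_mul_of_nonneg_left (hc' M) (by positivity)
        _ = d * ∑ M ∈ Finset.range (N + 1), (1 - d) ^ M * wordExp p M (stopGain μ []) +
              d * ∑ M ∈ Finset.range (N + 1), (1 - d) ^ M * p ^ M := by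
            rw [Finset.sum_add_distrib, mul_add]
        _ ≤ _ := by
            rw [div_eq_mul_inv]
            exact add_le_add h2 (mul_le_mul_of_nonneg_left h3 hd0.le)
    refine le_of_tendsto (f := fun N : ℕ => c * (1 - (1 - d) ^ (N + 1))) (x := Filter.atTop) ?_
      (Filter.Eventually.of_forall hN)
    have := (tendsto_pow_atTop_nhds_zero_of_lt_one h1d.le (by linarith : 1 - d < 1)).comp
      (Filter.tendsto_add_atTop_nat 1)
    simpa using (this.const_sub 1).const_mul c
  have hlim : Filter.Tendsto (fun d : ℝ => k * (1 - (1 - d) * (1 - p)) ^ k * ((1 - d) * (1 - p)) +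
      d / (1 - p)) (nhdsWithin 0 (Set.Ioi 0)) (nhds (k * p ^ k * (1 - p))) := by
    have : Continuous fun d : ℝ => k * (1 - (1 - d) * (1 - p)) ^ k * ((1 - d) * (1 - p)) +
      d / (1 - p) := by fun_prop
    have h := (this.tendsto 0).mono_left (nhdsWithin_le_nhds (s := Set.Ioi 0))
    simpa using h
  -- Killing lowers the online probability to `(1 - d) (1 - p)`. The strict inequality `hkp'`
  -- survives this for small `d`, so the same `k` stays optimal.
  refine ge_of_tendsto hlim ?_
  have hcont : Continuous fun d : ℝ => ((k : ℝ) + 1) * ((1 - d) * (1 - p)) := by fun_prop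
  have hev : ∀ᶠ d : ℝ in nhds 0, 1 < ((k : ℝ) + 1) * ((1 - d) * (1 - p)) :=
    hcont.continuousAt.eventually_const_lt (by simpa using hkp')
  filter_upwards [self_mem_nhdsWithin, nhdsWithin_le_nhds hev,
    nhdsWithin_le_nhds (eventually_lt_nhds (zero_lt_one' ℝ))] with d h0 h1 h2
  exact hd d h0 h2 h1.le

/-! ### Binomial distributions with close parameters -/

/-- Expectation of `f` under the binomial distribution with parameters `n` and `p`. -/
noncomputable def binomExp (p : ℝ) : ℕ → (ℕ → ℝ) → ℝ
  | 0, f => f 0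
  | n + 1, f => p * binomExp p n (fun a => f (a + 1)) + (1 - p) * binomExp p n f

theorem wordExp_count (p : ℝ) (n : ℕ) (f : ℕ → ℝ) :
    (wordExp p n fun t => f (t.count true)) = binomExp p n f := by
  induction n generalizing f with
  | zero => simp [wordExp, binomExp]
  | succ n ih =>
    have := ih fun a => f (a + 1)
    simp [wordExp, binomExp, ih, this]

theorem binomExp_add (p : ℝ) (n : ℕ) (f g : ℕ → ℝ) :
    binomExp p n (fun a => f a + g a) = binomExp p n f + binomExp p n g := by
  simp only [← wordExp_count, wordExp_add]

theorem binomExp_mul_left (p : ℝ) (n : ℕ) (c : ℝ) (f : ℕ → ℝ) :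
    binomExp p n (fun a => c * f a) = c * binomExp p n f := by
  simp only [← wordExp_count, wordExp_mul_left]

theorem binomExp_const (p : ℝ) (n : ℕ) (c : ℝ) : binomExp p n (fun _ => c) = c := by
  rw [← wordExp_count, wordExp_const]

theorem binomExp_mono {p : ℝ} (hp0 : 0 ≤ p) (hp1 : p ≤ 1) (n : ℕ) {f g : ℕ → ℝ}
    (h : ∀ a, f a ≤ g a) : binomExp p n f ≤ binomExp p n g := by
  simp only [← wordExp_count]
  exact wordExp_mono hp0 hp1 fun _ _ => h _

/-- Stein's identity for the binomial distribution. -/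
theorem binomExp_stein (p : ℝ) (n : ℕ) (f : ℕ → ℝ) :
    binomExp p (n + 1) (fun a => (a - (n + 1) * p) * f a) =
      (n + 1) * p * (1 - p) * (binomExp p n (fun a => f (a + 1)) - binomExp p n f) := by
  induction n generalizing f with
  | zero => simp only [binomExp]; push_cast; ring
  | succ n ih =>
    have h1 : (fun a : ℕ => (((a + 1 : ℕ) : ℝ) - ((n + 1 : ℕ) + 1) * p) * f (a + 1)) =
        fun a : ℕ => (a - (n + 1) * p) * f (a + 1) + (1 - p) * f (a + 1) := by
      funext a; push_cast; ring
    have h2 : (fun a : ℕ => ((a : ℝ) - ((n + 1 : ℕ) + 1) * p) * f a) =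
        fun a : ℕ => (a - (n + 1) * p) * f a + -p * f a := by
      funext a; push_cast; ring
    rw [binomExp, h1, h2, binomExp_add, binomExp_add, ih f, ih (fun a => f (a + 1)),
      binomExp_mul_left, binomExp_mul_left]
    simp only [binomExp]
    push_cast
    ring

theorem binomExp_variance (p : ℝ) (n : ℕ) :
    binomExp p (n + 1) (fun a => (a - (n + 1) * p) ^ 2) = (n + 1) * p * (1 - p) := by
  have h1 : binomExp p n (fun a => ((a + 1 : ℕ) : ℝ) - (n + 1) * p) =
      1 + binomExp p n (fun a => (a : ℝ) - (n + 1) * p) := by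
    rw [← binomExp_const p n 1, ← binomExp_add]
    congr 1; funext a
    rw [binomExp_const]; push_cast; ring
  simp only [pow_two]
  rw [binomExp_stein, h1]
  ring

/-- By conditioning on one trial the difference is `p` times the mean increment of `f`, which
Stein's identity turns into a covariance-type expectation. This is at most the mean deviation of the
binomial variable, of order the square root of `n + 1`. -/
theorem abs_binomExp_succ_sub_le {p : ℝ} (hp0 : 0 ≤ p) (hp1 : p < 1) (n : ℕ) {f : ℕ → ℝ}
    (hf0 : ∀ a, 0 ≤ f a) (hf1 : ∀ a, f a ≤ 1) :
    |binomExp p (n + 1) f - binomExp p n f| ≤ 1 / ((1 - p) * √(n + 1)) := by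
  have h1p : 0 < 1 - p := by linarith
  have hn : (0 : ℝ) < n + 1 := by positivity
  obtain ⟨θ, hθ⟩ : ∃ θ, θ = √((n : ℝ) + 1) := ⟨_, rfl⟩
  have hθ0 : 0 < θ := by rw [hθ]; positivity
  have hθ2 : θ * θ = n + 1 := by rw [hθ]; exact Real.mul_self_sqrt hn.le
  have hW : |binomExp p (n + 1) (fun a => (a - (n + 1) * p) * f a)| ≤ θ := by
    -- The inequality of arithmetic and geometric means replaces the absolute value by a square, so
    -- that the variance suffices.
    have hy : ∀ y z : ℝ, 0 ≤ z → z ≤ 1 → |y * z| ≤ (2 * θ)⁻¹ * y ^ 2 + θ / 2 := by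
      intro y z hz0 hz1
      have h2 : |y| ≤ (2 * θ)⁻¹ * y ^ 2 + θ / 2 := by
        have : (2 * θ)⁻¹ * y ^ 2 + θ / 2 - |y| = (2 * θ)⁻¹ * (|y| - θ) ^ 2 := by
          rw [← sq_abs y]; field_simp; ring
        have h3 : 0 ≤ (2 * θ)⁻¹ * (|y| - θ) ^ 2 := by positivity
        linarith
      rw [abs_mul, abs_of_nonneg hz0]
      exact (mul_le_of_le_one_right (abs_nonneg y) hz1).trans h2
    have hB : binomExp p (n + 1) (fun a => (2 * θ)⁻¹ * ((a : ℝ) - (n + 1) * p) ^ 2 + θ / 2) ≤ θ := by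
      rw [binomExp_add, binomExp_mul_left, binomExp_variance, binomExp_const, ← hθ2]
      have h3 : p * (1 - p) ≤ 1 := by nlinarith
      have h4 : (2 * θ)⁻¹ * (θ * θ * p * (1 - p)) = θ / 2 * (p * (1 - p)) := by field_simp
      rw [h4]
      nlinarith
    rw [abs_le]
    constructor
    · have h5 := binomExp_mono hp0 hp1.le (n + 1)
        (f := fun a => -1 * ((2 * θ)⁻¹ * ((a : ℝ) - (n + 1) * p) ^ 2 + θ / 2))
        (g := fun a => (a - (n + 1) * p) * f a) fun a => by
          have := (abs_le.1 (hy (a - (n + 1) * p) (f a) (hf0 a) (hf1 a))).1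
          linarith
      rw [binomExp_mul_left] at h5
      linarith
    · exact (binomExp_mono hp0 hp1.le (n + 1) fun a =>
        (abs_le.1 (hy (a - (n + 1) * p) (f a) (hf0 a) (hf1 a))).2).trans hB
  rw [binomExp_stein] at hW
  have h6 : binomExp p (n + 1) f - binomExp p n f =
      p * (binomExp p n (fun a => f (a + 1)) - binomExp p n f) := by rw [binomExp]; ring
  have h7 : (n + 1) * p * (1 - p) * (binomExp p n (fun a => f (a + 1)) - binomExp p n f) =
      (1 - p) * θ * θ * (binomExp p (n + 1) f - binomExp p n f) := by
    rw [h6, ← hθ2]; ring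
  rw [h7, abs_mul, abs_of_pos (by positivity)] at hW
  rw [← hθ, le_div_iff₀ (by positivity)]
  refine le_of_mul_le_mul_right ?_ hθ0
  linarith

theorem abs_binomExp_add_sub_le {p : ℝ} (hp0 : 0 ≤ p) (hp1 : p < 1) (T M : ℕ) {f : ℕ → ℝ}
    (hf0 : ∀ a, 0 ≤ f a) (hf1 : ∀ a, f a ≤ 1) :
    |binomExp p (T + M) f - binomExp p T f| ≤ M * (1 / ((1 - p) * √(T + 1))) := by
  have h1p : 0 < 1 - p := by linarith
  induction M with
  | zero => simp
  | succ M ih =>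
    have h1 := abs_binomExp_succ_sub_le hp0 hp1 (T + M) hf0 hf1
    have h2 : 1 / ((1 - p) * √((T + M : ℕ) + 1)) ≤ 1 / ((1 - p) * √(T + 1)) := by
      gcongr
      linarith [Nat.cast_nonneg (α := ℝ) M]
    calc |binomExp p (T + (M + 1)) f - binomExp p T f| ≤
          |binomExp p (T + M + 1) f - binomExp p (T + M) f| +
            |binomExp p (T + M) f - binomExp p T f| := abs_sub_le _ _ _
      _ ≤ _ := by push_cast at *; linarith

theorem tendsto_binomExp_sub {p : ℝ} (hp0 : 0 ≤ p) (hp1 : p < 1) (M : ℕ) {f : ℕ → ℕ → ℝ}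
    (hf0 : ∀ n a, 0 ≤ f n a) (hf1 : ∀ n a, f n a ≤ 1) :
    Filter.Tendsto (fun n => binomExp p (n - M) (f n) - binomExp p n (f n)) Filter.atTop
      (nhds 0) := by
  rw [← Filter.tendsto_add_atTop_iff_nat M]
  refine squeeze_zero_norm (a := fun T : ℕ => M * (1 / ((1 - p) * √((T : ℝ) + 1)))) ?_ ?_
  · intro T
    rw [Nat.add_sub_cancel, Real.norm_eq_abs, abs_sub_comm]
    exact abs_binomExp_add_sub_le hp0 hp1 T M (hf0 _) (hf1 _)
  · have h1 : Filter.Tendsto (fun T : ℕ => √((T : ℝ) + 1)) Filter.atTop Filter.atTop :=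
      Real.tendsto_sqrt_atTop.comp
        (Filter.tendsto_atTop_add_const_right _ _ tendsto_natCast_atTop_atTop)
    have h2 := (h1.const_mul_atTop (by linarith : 0 < 1 - p)).inv_tendsto_atTop
    simpa using h2.const_mul (M : ℝ)

/-! ### A generic increasing sequence of values -/

/-- The ultrafilter of generic increasing lists of length `n`: each entry is arbitrarily large, and
the later ones are arbitrarily large in comparison with the earlier ones. -/
noncomputable def genericList : ℕ → Ultrafilter (List ℝ)
  | 0 => pure []
  | n + 1 => (Ultrafilter.of (Filter.atTop : Filter ℝ)).bind fun x => (genericList n).map (x :: ·)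

theorem eventually_genericList_succ {n : ℕ} {P : List ℝ → Prop} :
    (∀ᶠ l in genericList (n + 1), P l) ↔
      ∀ᶠ x in Ultrafilter.of (Filter.atTop : Filter ℝ), ∀ᶠ l in genericList n, P (x :: l) :=
  Iff.rfl

theorem eventually_genericList_length (n : ℕ) : ∀ᶠ l : List ℝ in genericList n, l.length = n := by
  induction n with
  | zero => exact rfl
  | succ n ih =>
    rw [eventually_genericList_succ]
    exact Filter.Eventually.of_forall fun x => ih.mono fun l hl => by simp [hl]

theorem eventually_genericList_gt (n : ℕ) (a : ℝ) : ∀ᶠ l : List ℝ in genericList n, ∀ y ∈ l, a < y := by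
  induction n with
  | zero => exact fun y hy => absurd hy List.not_mem_nil
  | succ n ih =>
    rw [eventually_genericList_succ]
    have h : ∀ᶠ x in Ultrafilter.of (Filter.atTop : Filter ℝ), a < x :=
      Ultrafilter.of_le _ (Filter.eventually_gt_atTop a)
    exact h.mono fun x hx => ih.mono fun l hl y hy => by
      rcases List.mem_cons.1 hy with rfl | hy
      exacts [hx, hl y hy]

theorem eventually_genericList_sorted (n : ℕ) :
    ∀ᶠ l : List ℝ in genericList n, l.Pairwise (· < ·) := by
  induction n with
  | zero => exact List.Pairwise.nil
  | succ n ih =>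
    rw [eventually_genericList_succ]
    exact Filter.Eventually.of_forall fun x => (ih.and (eventually_genericList_gt n x)).mono
      fun l hl => List.pairwise_cons.2 ⟨hl.2, hl.1⟩

/-- The entries of `l` at the positions of the letters `c` of the word. -/
def select {β : Type*} (c : Bool) : List Bool → List β → List β
  | b :: w, x :: l => if b = c then x :: select c w l else select c w l
  | _, _ => []

/-- Remove from `l` the entries at the positions of the letters `false` of the word, and keep all
entries beyond the length of the word. -/
def prune {β : Type*} : List Bool → List β → List β
  | [], l => l
  | _ :: _, [] => []
  | b :: t, x :: l => if b then x :: prune t l else prune t l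

/-- All entries are drawn from one and the same ultrafilter, so a generic list with fixed positions
deleted is again generic. This plays the role of Ramsey's theorem. -/
theorem tendsto_prune (t : List Bool) (M : ℕ) :
    Filter.Tendsto (prune (β := ℝ) t) (genericList (t.length + M)) (genericList (t.count true + M)) := by
  rw [Filter.tendsto_iff_eventually]
  induction t with
  | nil => intro P h; simpa [prune] using h
  | cons b t ih =>
    intro P h
    rw [List.length_cons, Nat.add_right_comm, eventually_genericList_succ]
    cases b with
    | true =>
      rw [List.count_cons_self, Nat.add_right_comm, eventually_genericList_succ] at h
      exact h.mono fun x hx => by simpa [prune] using ih hx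
    | false =>
      have h : ∀ᶠ l in genericList (t.count true + M), P l := by simpa using h
      exact Filter.Eventually.of_forall fun x => by simpa [prune] using ih h

theorem tendsto_dropAtLast {u : List Bool} (hu : false ∈ u) :
    Filter.Tendsto (dropAtLast (β := ℝ) u) (genericList u.length)
      (genericList (dropLastFalse u).length) := by
  rw [Filter.tendsto_iff_eventually]
  induction u with
  | nil => simp at hu
  | cons b w ih =>
    intro P h
    rw [List.length_cons, eventually_genericList_succ]
    by_cases hw : false ∈ w
    · have hd : dropLastFalse (b :: w) = b :: dropLastFalse w := by
        simp [dropLastFalse, dropAtLast, hw]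
      rw [hd, List.length_cons, eventually_genericList_succ] at h
      exact h.mono fun x hx => by simpa [dropAtLast, hw] using ih hw hx
    · obtain rfl : b = false := by simpa [hw, eq_comm] using hu
      rw [dropLastFalse_false_cons hw] at h
      exact Filter.Eventually.of_forall fun x => by simpa [dropAtLast, hw] using h

/-! ### Selecting and deleting entries along a word -/

section Select

variable {β : Type*}

theorem select_append (c : Bool) {t w : List Bool} {l₁ l₂ : List β} (h : t.length = l₁.length) :
    select c (t ++ w) (l₁ ++ l₂) = select c t l₁ ++ select c w l₂ := by
  induction t generalizing l₁ with
  | nil => simp [List.length_eq_zero_iff.1 h.symm, select]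
  | cons b t ih =>
    obtain ⟨x, l₁, rfl⟩ := List.exists_cons_of_length_eq_add_one h.symm
    have := ih (l₁ := l₁) (by simpa using h)
    by_cases hb : b = c <;> simp [select, hb, this]

theorem prune_append {t : List Bool} {l₁ l₂ : List β} (h : t.length = l₁.length) :
    prune t (l₁ ++ l₂) = select true t l₁ ++ l₂ := by
  induction t generalizing l₁ with
  | nil => simp [List.length_eq_zero_iff.1 h.symm, select, prune]
  | cons b t ih =>
    obtain ⟨x, l₁, rfl⟩ := List.exists_cons_of_length_eq_add_one h.symm
    have := ih (l₁ := l₁) (by simpa using h)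
    by_cases hb : b = true <;> simp [select, prune, hb, this]

theorem length_select {c : Bool} {t : List Bool} {l : List β} (h : t.length = l.length) :
    (select c t l).length = t.count c := by
  induction t generalizing l with
  | nil => simp [select]
  | cons b t ih =>
    obtain ⟨x, l, rfl⟩ := List.exists_cons_of_length_eq_add_one h.symm
    have := ih (l := l) (by simpa using h)
    by_cases hb : b = c <;> simp [select, hb, this]

theorem select_true_replicate (l : List β) :
    select true (List.replicate l.length true) l = l := by
  induction l with
  | nil => rfl
  | cons x l ih => simp [List.replicate_succ, select, ih]

theorem select_false_replicate (l : List β) :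
    select false (List.replicate l.length true) l = [] := by
  induction l with
  | nil => rfl
  | cons x l ih => simp [List.replicate_succ, select, ih]

theorem select_sublist (c : Bool) (w : List Bool) (l : List β) : (select c w l).Sublist l := by
  induction w generalizing l with
  | nil => simp [select]
  | cons b w ih =>
    cases l with
    | nil => simp [select]
    | cons x l =>
      by_cases hb : b = c
      · simpa [select, hb] using ih l
      · simpa [select, hb] using (ih l).trans (List.sublist_cons_self x l)

theorem select_eq_nil_iff {c : Bool} {w : List Bool} {l : List β} (h : w.length = l.length) :
    select c w l = [] ↔ c ∉ w := by
  rw [← List.length_eq_zero_iff, length_select h, List.count_eq_zero]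

theorem select_true_dropAtLast {u : List Bool} {l : List β} (h : u.length = l.length) :
    select true (dropLastFalse u) (dropAtLast u l) = select true u l := by
  induction u generalizing l with
  | nil => simp [List.length_eq_zero_iff.1 h.symm, select, dropLastFalse, dropAtLast]
  | cons b w ih =>
    obtain ⟨x, l, rfl⟩ := List.exists_cons_of_length_eq_add_one h.symm
    have := ih (l := l) (by simpa using h)
    unfold dropLastFalse at this
    by_cases hw : false ∈ w <;> cases b <;> simp [select, dropLastFalse, dropAtLast, hw, this]

theorem select_false_dropAtLast {u : List Bool} {l : List β} (h : u.length = l.length)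
    (hu : false ∈ u) :
    select false (dropLastFalse u) (dropAtLast u l) = (select false u l).dropLast := by
  induction u generalizing l with
  | nil => simp at hu
  | cons b w ih =>
    obtain ⟨x, l, rfl⟩ := List.exists_cons_of_length_eq_add_one h.symm
    have hl : w.length = l.length := by simpa using h
    by_cases hw : false ∈ w
    · have := ih hl hw
      unfold dropLastFalse at this
      have hne : select false w l ≠ [] := fun h0 => (select_eq_nil_iff hl).1 h0 hw
      cases b <;> simp [select, dropLastFalse, dropAtLast, hw, this, List.dropLast_cons_of_ne_nil hne]
    · obtain rfl : b = false := by simpa [hw, eq_comm] using hu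
      have := (select_eq_nil_iff hl).2 hw
      simp [select, dropLastFalse, dropAtLast, hw, this]

theorem select_map {ι : Type*} (c : Bool) (b : ι → Bool) (α : ι → β) (L : List ι) :
    select c (L.map b) (L.map α) = (L.filter fun i => b i = c).map α := by
  induction L with
  | nil => rfl
  | cons i L ih => by_cases hb : b i = c <;> simp [select, hb, ih]

end Select

/-! ### Ordinal algorithms from arbitrary ones -/

/-- The player rejects all values of the online sequence `vs`. -/
def Rejects (acc : List ℝ → Prop) (vs : List ℝ) : Prop :=
  ∀ s < vs.length, ¬ acc (vs.take (s + 1))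

theorem Rejects.dropLast {acc : List ℝ → Prop} {vs : List ℝ} (h : Rejects acc vs) :
    Rejects acc vs.dropLast := by
  intro s hs
  rw [List.length_dropLast] at hs
  rw [List.dropLast_eq_take, List.take_take, min_eq_left (by omega)]
  exact h s (by omega)

/-- If the large values arrive first, in increasing order, a winning player stops at the last of
them. -/
theorem Wins.rejects {acc : List ℝ → Prop} {h l : List ℝ} (hh : h ≠ [])
    (hsorted : h.Pairwise (· < ·)) (hl : ∀ x ∈ l, ∀ y ∈ h, x < y) (hw : Wins acc (h ++ l)) :
    Rejects acc h.dropLast ∧ ¬ Rejects acc h := by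
  have hpos : 0 < h.length := List.length_pos_of_ne_nil hh
  rcases hw with hw | ⟨⟨t, ht⟩, ⟨hacc, hnot⟩, hmax⟩
  · simp [hh] at hw
  simp only [List.get_eq_getElem] at hmax hacc hnot
  have hlast : h[h.length - 1] ≤ (h ++ l)[t] :=
    hmax _ (List.mem_append_left _ (List.getElem_mem _))
  have htj : t = h.length - 1 := by
    rcases lt_trichotomy t (h.length - 1) with hlt | heq | hgt
    · rw [List.getElem_append_left (by omega)] at hlast
      exact absurd (List.pairwise_iff_getElem.1 hsorted _ _ (by omega) (by omega) hlt)
        (not_lt.2 hlast)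
    · exact heq
    · rw [List.getElem_append_right (by omega)] at hlast
      exact absurd (hl _ (List.getElem_mem _) _ (List.getElem_mem _)) (not_lt.2 hlast)
  subst htj
  constructor
  · intro s hs
    rw [List.length_dropLast] at hs
    have := hnot s hs
    rw [List.take_append_of_le_length (by omega)] at this
    rwa [List.dropLast_eq_take, List.take_take, min_eq_left (by omega)]
  · intro hrej
    refine hrej (h.length - 1) (by omega) ?_
    rwa [List.take_append_of_le_length (by omega)] at hacc

/-- The probability that `A` rejects all online values, when the values seen are `l` and the word
`u` tells which of them are sampled. -/
noncomputable def rejectProb (A : Algorithm.{u}) (n : ℕ) (u : List Bool) (l : List ℝ) : ℝ :=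
  A.law.real {ω | Rejects (A.accept n ω (select true u l).toFinset) (select false u l)}

theorem measurableSet_rejects (A : Algorithm.{u}) (n : ℕ) (S : Finset ℝ) (vs : List ℝ) :
    MeasurableSet {ω | Rejects (A.accept n ω S) vs} := by
  have : {ω | Rejects (A.accept n ω S) vs} =
      ⋂ s : Fin vs.length, {ω | A.accept n ω S (vs.take (s + 1))}ᶜ := by
    ext ω
    simp [Rejects, Fin.forall_iff]
  rw [this]
  exact MeasurableSet.iInter fun s => (A.measurableSet_accept n S _).compl

theorem rejectProb_nonneg (A : Algorithm.{u}) (n : ℕ) (u : List Bool) (l : List ℝ) :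
    0 ≤ rejectProb A n u l := measureReal_nonneg

theorem rejectProb_le_one (A : Algorithm.{u}) (n : ℕ) (u : List Bool) (l : List ℝ) :
    rejectProb A n u l ≤ 1 := measureReal_le_one

theorem rejectProb_le_dropLast (A : Algorithm.{u}) (n : ℕ) {u : List Bool} (hu : false ∈ u)
    {l : List ℝ} (hl : u.length = l.length) :
    rejectProb A n u l ≤ rejectProb A n (dropLastFalse u) (dropAtLast u l) := by
  unfold rejectProb
  rw [select_true_dropAtLast hl, select_false_dropAtLast hl hu]
  exact measureReal_mono fun ω hω => Rejects.dropLast hω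

/-- A winner rejects all online values of `l₂` but the last and then stops, an event whose
probability is a difference of rejection probabilities. The online values of `l₁` arrive too late to
influence it, so they are pruned and only the samples of `t` remain in the pattern. -/
theorem winProb_le_rejectProb_sub (A : Algorithm.{u}) (n : ℕ) {t w : List Bool} {l₁ l₂ : List ℝ}
    (ht : t.length = l₁.length) (hw : w.length = l₂.length) (hfw : false ∈ w)
    (hsorted : (l₁ ++ l₂).Pairwise (· < ·)) :
    A.law.real {ω | Wins (A.accept n ω (select true (t ++ w) (l₁ ++ l₂)).toFinset)
      (select false w l₂ ++ select false t l₁)} ≤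
      rejectProb A n (dropLastFalse (List.replicate (t.count true) true ++ w))
        (dropAtLast (List.replicate (t.count true) true ++ w) (prune t (l₁ ++ l₂))) -
      rejectProb A n (List.replicate (t.count true) true ++ w) (prune t (l₁ ++ l₂)) := by
  have hlen : (List.replicate (t.count true) true).length = (select true t l₁).length := by
    rw [List.length_replicate, length_select ht]
  rw [prune_append ht]
  unfold rejectProb
  rw [select_true_dropAtLast (by simp [← length_select ht, hw]),
    select_false_dropAtLast (by simp [← length_select ht, hw]) (by simp [hfw]),
    select_append _ hlen, select_append _ hlen, select_append _ ht, ← length_select ht,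
    select_true_replicate, select_false_replicate, List.nil_append]
  set S := (select true t l₁ ++ select true w l₂).toFinset
  set h := select false w l₂
  have hsub : {ω | Rejects (A.accept n ω S) h} ⊆ {ω | Rejects (A.accept n ω S) h.dropLast} :=
    fun ω hω => Rejects.dropLast hω
  rw [← measureReal_sdiff hsub (measurableSet_rejects A n S h)]
  refine measureReal_mono fun ω hω => ?_
  rw [List.pairwise_append] at hsorted
  refine Wins.rejects (fun h0 => (select_eq_nil_iff hw).1 h0 hfw)
    (hsorted.2.1.sublist (select_sublist _ _ _)) ?_ hω
  intro x hx y hy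
  exact hsorted.2.2 x ((select_sublist _ _ _).subset hx) y ((select_sublist _ _ _).subset hy)

theorem exists_perm_ofFn_eq {n : ℕ} {L : List (Fin n)} (hnd : L.Nodup) (hlen : L.length = n) :
    ∃ σ : Equiv.Perm (Fin n), List.ofFn σ = L := by
  have hinj : Function.Injective fun i : Fin n => L.get (i.cast hlen.symm) :=
    (List.nodup_iff_injective_get.1 hnd).comp (Fin.cast_injective _)
  refine ⟨Equiv.ofBijective _ (Finite.injective_iff_bijective.1 hinj), ?_⟩
  refine List.ext_getElem (by simp [hlen]) fun i h1 h2 => ?_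
  simp

/-- The instance in which the values are `l`, the `T` smallest elements arrive last, and the others
arrive first in increasing order. -/
theorem exists_winProb_eq (p : ℝ) (A : Algorithm.{u}) {n : ℕ} (T : ℕ) {l : List ℝ}
    (hlen : l.length = n) (hnd : l.Nodup) :
    ∃ (α : Fin n ↪ ℝ) (σ : Equiv.Perm (Fin n)), winProb p A α (fun _ => σ) =
      wordExp p n fun W => A.law.real {ω | Wins (A.accept n ω (select true W l).toFinset)
        (select false (W.drop T) (l.drop T) ++ select false (W.take T) (l.take T))} := by
  obtain ⟨α, rfl⟩ : ∃ α : Fin n ↪ ℝ, l = (List.finRange n).map α := by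
    subst hlen
    refine ⟨⟨l.get, List.nodup_iff_injective_get.1 hnd⟩, ?_⟩
    rw [← List.ofFn_eq_map]
    exact (List.ofFn_get l).symm
  obtain ⟨σ, hσ⟩ := exists_perm_ofFn_eq
    (L := (List.finRange n).drop T ++ (List.finRange n).take T)
    (List.nodup_append_comm.1 (by rw [List.take_append_drop]; exact List.nodup_finRange _))
    (by rw [List.length_append, add_comm, ← List.length_append, List.take_append_drop,
      List.length_finRange])
  refine ⟨α, σ, ?_⟩
  rw [← sum_finset_eq_wordExp p 1, winProb]
  refine Finset.sum_congr rfl fun S _ => ?_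
  have hW : (List.ofFn fun i => decide ((1 : Equiv.Perm (Fin n)) i ∈ S)) =
      (List.finRange n).map fun i => decide (i ∈ S) := by
    rw [List.ofFn_eq_map]; rfl
  have hS : S.map α = (select true ((List.finRange n).map fun i => decide (i ∈ S))
      ((List.finRange n).map α)).toFinset := by
    rw [select_map]
    ext x
    simp
  have hO : onlineValues α σ S =
      select false (((List.finRange n).map fun i => decide (i ∈ S)).drop T)
        (((List.finRange n).map α).drop T) ++
      select false (((List.finRange n).map fun i => decide (i ∈ S)).take T)
        (((List.finRange n).map α).take T) := by
    rw [onlineValues, hσ, ← List.map_drop, ← List.map_take, ← List.map_drop, ← List.map_take,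
      select_map, select_map, List.filter_append, List.map_append]
    simp
  simp only [hW, hS, hO]

theorem exists_tendsto_of_mem_Icc {ι : Type*} (F : Ultrafilter ι) {f : ι → ℝ}
    (hf0 : ∀ i, 0 ≤ f i) (hf1 : ∀ i, f i ≤ 1) :
    ∃ x, Filter.Tendsto f F (nhds x) := by
  obtain ⟨x, -, hx⟩ := (isCompact_Icc (a := (0 : ℝ)) (b := 1)).ultrafilter_le_nhds' (F.map f)
    (Ultrafilter.mem_map.2 (Filter.univ_mem' fun i => ⟨hf0 i, hf1 i⟩))
  exact ⟨x, hx⟩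

/-- The reduction to ordinal algorithms: successive limits over values and over sizes produce a
function `μ` to which `le_of_forall_le_wordExp` applies. -/
theorem le_of_forall_le_winProb {p : ℝ} (hp0 : 0 ≤ p) (hp1 : p < 1) {k : ℕ}
    (hkp : k * (1 - p) ≤ 1) (hkp' : 1 < (k + 1) * (1 - p)) (A : Algorithm.{u}) {c : ℝ}
    (hc : ∀ (n : ℕ) (α : Fin n ↪ ℝ) (σ : Equiv.Perm (Fin n)), c ≤ winProb p A α (fun _ => σ)) :
    c ≤ k * p ^ k * (1 - p) := by
  -- `D n u` is the rejection probability on pattern `u` for generic values, for a player told that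
  -- the size is `n`. It exists because bounded functions converge along ultrafilters.
  choose D hD using fun (n : ℕ) (u : List Bool) => exists_tendsto_of_mem_Icc (genericList u.length)
    (rejectProb_nonneg A n u) (rejectProb_le_one A n u)
  have hD0 : ∀ n u, 0 ≤ D n u := fun n u =>
    ge_of_tendsto (hD n u) (Filter.Eventually.of_forall (rejectProb_nonneg A n u))
  have hD1 : ∀ n u, D n u ≤ 1 := fun n u =>
    le_of_tendsto (hD n u) (Filter.Eventually.of_forall (rejectProb_le_one A n u))
  have hDmono : ∀ n u, false ∈ u → D n u ≤ D n (dropLastFalse u) := fun n u hu =>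
    le_of_tendsto_of_tendsto (hD n u) ((hD n (dropLastFalse u)).comp (tendsto_dropAtLast hu))
      ((eventually_genericList_length u.length).mono fun l hl =>
        rejectProb_le_dropLast A n hu hl.symm)
  have hordinal : ∀ T M, c ≤ wordExp p M fun w => if false ∈ w then
      binomExp p T (fun a => D (T + M) (List.replicate a true ++ dropLastFalse w)) -
        binomExp p T (fun a => D (T + M) (List.replicate a true ++ w)) else 1 := by
    intro T M
    have hlim : Filter.Tendsto (fun l => wordExp p T fun t => wordExp p M fun w =>
        if false ∈ w then
          rejectProb A (T + M) (dropLastFalse (List.replicate (t.count true) true ++ w))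
            (dropAtLast (List.replicate (t.count true) true ++ w) (prune t l)) -
          rejectProb A (T + M) (List.replicate (t.count true) true ++ w) (prune t l) else 1)
        (genericList (T + M)) (nhds (wordExp p T fun t => wordExp p M fun w =>
          if false ∈ w then
            D (T + M) (dropLastFalse (List.replicate (t.count true) true ++ w)) -
            D (T + M) (List.replicate (t.count true) true ++ w) else 1)) := by
      refine tendsto_wordExp p T fun t ht => tendsto_wordExp p M fun w hw => ?_
      split_ifs with hfw
      · have h1 := tendsto_prune t M
        have h2 : t.count true + M = (List.replicate (t.count true) true ++ w).length := by
          simp [hw]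
        rw [ht, h2] at h1
        exact ((hD _ _).comp ((tendsto_dropAtLast (by simp [hfw])).comp h1)).sub ((hD _ _).comp h1)
      · exact tendsto_const_nhds
    have hle : c ≤ wordExp p T fun t => wordExp p M fun w =>
          if false ∈ w then
            D (T + M) (dropLastFalse (List.replicate (t.count true) true ++ w)) -
            D (T + M) (List.replicate (t.count true) true ++ w) else 1 := by
      refine ge_of_tendsto hlim ?_
      filter_upwards [eventually_genericList_length (T + M), eventually_genericList_sorted (T + M)]
        with l hlen hsorted
      obtain ⟨α, σ, hασ⟩ := exists_winProb_eq p A T hlen (hsorted.imp ne_of_lt)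
      refine (hc _ α σ).trans ?_
      rw [hασ, wordExp_append]
      refine wordExp_mono hp0 hp1.le fun t ht => wordExp_mono hp0 hp1.le fun w hw => ?_
      have hl := List.take_append_drop T l
      split_ifs with hfw
      · have := winProb_le_rejectProb_sub A (T + M) (t := t) (w := w) (l₁ := l.take T)
          (l₂ := l.drop T) (by simp [ht, hlen]) (by simp [hw, hlen]) hfw (by rwa [hl])
        rw [hl] at this
        simpa [← ht] using this
      -- All `M` large elements are sampled, and the win is conceded.
      · exact measureReal_le_one
    refine hle.trans (le_of_eq ?_)
    rw [wordExp_comm]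
    refine wordExp_congr fun w _ => ?_
    split_ifs with hfw
    · rw [wordExp_sub, ← wordExp_count, ← wordExp_count]
      simp only [dropLastFalse_append hfw]
    · exact wordExp_const _ _ _
  have hB0 : ∀ n u, 0 ≤ binomExp p n (fun a => D n (List.replicate a true ++ u)) := fun n u => by
    rw [← binomExp_const p n 0]
    exact binomExp_mono hp0 hp1.le n fun a => hD0 _ _
  have hB1 : ∀ n u, binomExp p n (fun a => D n (List.replicate a true ++ u)) ≤ 1 := fun n u => by
    rw [← binomExp_const p n 1]
    exact binomExp_mono hp0 hp1.le n fun a => hD1 _ _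
  -- The number of samples among the small elements is averaged with parameter `n` instead of `n -
  -- M`, so that `μ` does not depend on `M`.
  choose μ hμ using fun u : List Bool => exists_tendsto_of_mem_Icc (Filter.hyperfilter ℕ)
    (fun n => hB0 n u) (fun n => hB1 n u)
  refine le_of_forall_le_wordExp hp0 hp1 hkp hkp' (μ := μ)
    (fun u => ge_of_tendsto (hμ u) (Filter.Eventually.of_forall fun n => hB0 n u))
    (fun u => le_of_tendsto (hμ u) (Filter.Eventually.of_forall fun n => hB1 n u)) ?_ ?_
  · intro h m
    refine le_of_tendsto_of_tendsto (hμ _) (hμ _) (Filter.Eventually.of_forall fun n => ?_)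
    refine binomExp_mono hp0 hp1.le n fun a => ?_
    have := hDmono n (List.replicate a true ++ (h ++ false :: List.replicate m true)) (by simp)
    rwa [dropLastFalse_append (by simp), dropLastFalse_append_replicate] at this
  · intro M
    -- The true parameter `n - M` gives the same limit because the two binomial laws merge.
    have hμM : ∀ u, Filter.Tendsto
        (fun n => binomExp p (n - M) (fun a => D n (List.replicate a true ++ u)))
        (Filter.hyperfilter ℕ) (nhds (μ u)) := by
      intro u
      have h1 := (tendsto_binomExp_sub hp0 hp1 M (f := fun n a => D n (List.replicate a true ++ u))
        (fun n a => hD0 _ _) (fun n a => hD1 _ _)).mono_left Nat.hyperfilter_le_atTop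
      simpa using h1.add (hμ u)
    have hlim : Filter.Tendsto (fun n => wordExp p M fun w => if false ∈ w then
        binomExp p (n - M) (fun a => D n (List.replicate a true ++ dropLastFalse w)) -
          binomExp p (n - M) (fun a => D n (List.replicate a true ++ w)) else 1)
        (Filter.hyperfilter ℕ)
        (nhds (wordExp p M fun w => if false ∈ w then μ (dropLastFalse w) - μ w else 1)) := by
      refine tendsto_wordExp p M fun w _ => ?_
      split_ifs
      · exact (hμM _).sub (hμM _)
      · exact tendsto_const_nhds
    refine ge_of_tendsto hlim ?_
    filter_upwards [Nat.hyperfilter_le_atTop (Filter.eventually_ge_atTop M)] with n hn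
    have := hordinal (n - M) M
    rwa [Nat.sub_add_cancel hn] at this

/-! ### Success guarantees -/

theorem winProb_nonneg {p : ℝ} (hp0 : 0 ≤ p) (hp1 : p < 1) (A : Algorithm.{u}) {n : ℕ}
    (α : Fin n ↪ ℝ) (σ : Finset (Fin n) → Equiv.Perm (Fin n)) : 0 ≤ winProb p A α σ := by
  have : 0 ≤ 1 - p := by linarith
  exact Finset.sum_nonneg fun S _ => by positivity

theorem bddBelow_winProb {p : ℝ} (hp0 : 0 ≤ p) (hp1 : p < 1) (A : Algorithm.{u}) (n : ℕ) :
    BddBelow (Set.range fun x : (Fin n ↪ ℝ) × (Finset (Fin n) → Equiv.Perm (Fin n)) =>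
      winProb p A x.1 x.2) :=
  ⟨0, by rintro _ ⟨x, rfl⟩; exact winProb_nonneg hp0 hp1 A _ _⟩

theorem bddBelow_obliviousWinProb {p : ℝ} (hp0 : 0 ≤ p) (hp1 : p < 1) (A : Algorithm.{u}) (n : ℕ) :
    BddBelow (Set.range fun x : (Fin n ↪ ℝ) × Equiv.Perm (Fin n) =>
      winProb p A x.1 (fun _ => x.2)) :=
  ⟨0, by rintro _ ⟨x, rfl⟩; exact winProb_nonneg hp0 hp1 A _ _⟩

/-- The increasing values `0, 1, …, n - 1`. -/
noncomputable def natValues (n : ℕ) : Fin n ↪ ℝ :=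
  ⟨fun i => (i : ℕ), fun _ _ h => Fin.ext (Nat.cast_injective h)⟩

theorem strictMono_natValues (n : ℕ) : StrictMono (natValues n) := fun _ _ h =>
  Nat.cast_lt.2 h

theorem guarantee_le_winProb {p : ℝ} (hp0 : 0 ≤ p) (hp1 : p < 1) (A : Algorithm.{u}) {n : ℕ}
    (α : Fin n ↪ ℝ) (σ : Finset (Fin n) → Equiv.Perm (Fin n)) :
    guarantee p A ≤ winProb p A α σ := by
  -- A real infimum is a lower bound only for families bounded below; here `0` is a bound.
  refine (ciInf_le ⟨0, ?_⟩ n).trans (ciInf_le (bddBelow_winProb hp0 hp1 A n) (α, σ))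
  rintro _ ⟨m, rfl⟩
  exact Real.iInf_nonneg fun x => winProb_nonneg hp0 hp1 A _ _

theorem obliviousGuarantee_le_winProb {p : ℝ} (hp0 : 0 ≤ p) (hp1 : p < 1) (A : Algorithm.{u})
    {n : ℕ} (α : Fin n ↪ ℝ) (σ : Equiv.Perm (Fin n)) :
    obliviousGuarantee p A ≤ winProb p A α (fun _ => σ) := by
  refine (ciInf_le ⟨0, ?_⟩ n).trans (ciInf_le (bddBelow_obliviousWinProb hp0 hp1 A n) (α, σ))
  rintro _ ⟨m, rfl⟩
  exact Real.iInf_nonneg fun x => winProb_nonneg hp0 hp1 A _ _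

theorem successProb_kMax {p : ℝ} (hp0 : 0 ≤ p) (hp1 : p < 1) {k : ℕ} (hk : 1 ≤ k) {n : ℕ}
    (hn : k < n) : successProb p (kMax k) n = k * p ^ k * (1 - p) + p ^ n := by
  refine le_antisymm ?_ ?_
  · refine (ciInf_le (bddBelow_winProb hp0 hp1 _ n) (natValues n, fun _ => 1)).trans (le_of_eq ?_)
    rw [winProb_kMax_of_strictMono hk (strictMono_natValues n), if_pos hn]
  · have : Nonempty ((Fin n ↪ ℝ) × (Finset (Fin n) → Equiv.Perm (Fin n))) :=
      ⟨(natValues n, fun _ => 1)⟩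
    refine le_ciInf fun x => ?_
    have := le_winProb_kMax hp0 hp1 hk x.1 x.2
    rwa [if_pos hn] at this

theorem kMax_bound_le_guarantee {p : ℝ} (hp0 : 0 ≤ p) (hp1 : p < 1) {k : ℕ} (hk : 1 ≤ k) :
    k * p ^ k * (1 - p) ≤ guarantee p (kMax k) := by
  refine le_ciInf fun n => ?_
  have : Nonempty ((Fin n ↪ ℝ) × (Finset (Fin n) → Equiv.Perm (Fin n))) :=
    ⟨(natValues n, fun _ => 1)⟩
  exact le_ciInf fun x => kMax_bound_le_winProb hp0 hp1 hk x.1 x.2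

theorem kMax_bound_le_obliviousGuarantee {p : ℝ} (hp0 : 0 ≤ p) (hp1 : p < 1) {k : ℕ}
    (hk : 1 ≤ k) : k * p ^ k * (1 - p) ≤ obliviousGuarantee p (kMax k) := by
  refine le_ciInf fun n => ?_
  have : Nonempty ((Fin n ↪ ℝ) × Equiv.Perm (Fin n)) := ⟨(natValues n, 1)⟩
  exact le_ciInf fun x => kMax_bound_le_winProb hp0 hp1 hk x.1 _

end AOS

theorem mainTheorem1 (p : ℝ) (hp0 : 0 ≤ p) (hp1 : p < 1) (k : ℕ)
    (hk : k = ⌊1 / (1 - p)⌋₊) :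
    (∀ (n : ℕ) (α : Fin n ↪ ℝ) (σ : Finset (Fin n) → Equiv.Perm (Fin n)),
      k * p ^ k * (1 - p) ≤ AOS.winProb p (AOS.kMax k) α σ) ∧
    (∀ n : ℕ, k < n → AOS.successProb p (AOS.kMax k) n = k * p ^ k * (1 - p) + p ^ n) ∧
    AOS.guarantee p (AOS.kMax k) = k * p ^ k * (1 - p) ∧
    AOS.obliviousGuarantee p (AOS.kMax k) = k * p ^ k * (1 - p) ∧
    (∀ A : AOS.Algorithm.{u}, AOS.guarantee p A ≤ k * p ^ k * (1 - p)) ∧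
    (∀ A : AOS.Algorithm.{u}, AOS.obliviousGuarantee p A ≤ k * p ^ k * (1 - p)) := by
  have h1p : 0 < 1 - p := by linarith
  have hk1 : 1 ≤ k := by
    rw [hk, Nat.one_le_floor_iff, le_div_iff₀ h1p]
    linarith
  have hkp : k * (1 - p) ≤ 1 := by
    rw [← le_div_iff₀ h1p, hk]
    exact Nat.floor_le (by positivity)
  have hkp' : 1 < ((k : ℝ) + 1) * (1 - p) := by
    rw [← div_lt_iff₀ h1p, hk]
    exact Nat.lt_floor_add_one _
  refine ⟨fun n α σ => AOS.kMax_bound_le_winProb hp0 hp1 hk1 α σ,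
    fun n hn => AOS.successProb_kMax hp0 hp1 hk1 hn,
    le_antisymm ?_ (AOS.kMax_bound_le_guarantee hp0 hp1 hk1),
    le_antisymm ?_ (AOS.kMax_bound_le_obliviousGuarantee hp0 hp1 hk1), fun A => ?_, fun A => ?_⟩
  · exact AOS.le_of_forall_le_winProb hp0 hp1 hkp hkp' _ fun n α σ =>
      AOS.guarantee_le_winProb hp0 hp1 _ α _
  · exact AOS.le_of_forall_le_winProb hp0 hp1 hkp hkp' _ fun n α σ =>
      AOS.obliviousGuarantee_le_winProb hp0 hp1 _ α σ
  · exact AOS.le_of_forall_le_winProb hp0 hp1 hkp hkp' A fun n α σ =>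
      AOS.guarantee_le_winProb hp0 hp1 A α _
  · exact AOS.le_of_forall_le_winProb hp0 hp1 hkp hkp' A fun n α σ =>
      AOS.obliviousGuarantee_le_winProb hp0 hp1 A α σ
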